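/- **Setting.** Let $(X,d)$ be a Polish metric space and $d_L:X\times X\to[0,+\infty]$ a distance (possibly taking the value $+\infty$) which is Borel on $(X\times X,d\times d)$. A *geodesic* is a map $\gamma:I\to X$ on an interval $I\subset\mathbb R$ with $d_L(\gamma(s),\gamma(t))=|s-t|$ for all $s,t\in I$. Assume that any two points at finite $d_L$-distance are joined by a geodesic; that geodesics do not branch (two geodesics on $[a,c]$ which coincide on $[a,b]$ for some $a<b\le c$ coincide on $[a,c]$); that geodesics are $d$-continuous; and that they are locally compact in $(X,d)$: for every geodesic $\gamma$ and every $x\in\gamma(I)$ there is $r>0$ such that $\gamma^{-1}(\bar B_r(x))$ is compact, where $\bar B_r(x)$ is the closed $d$-ball. Let $\mu,\nu$ be Borel probability measures on $X$ and $\pi$ a transference plan from $\mu$ to $\nu$ (marginals $\mu,\nu$) with $\int d_L\,d\pi<\infty$, concentrated on a $d_L$-cyclically monotone set $\Gamma\subset\{d_L<\infty\}$ that is the union of an increasing sequence of compact sets $\Gamma_n$ with $d_L\llcorner_{\Gamma_n}$ continuous. Let $\Gamma'$ be the set of all $(x,y)$ for which there are $I\ge 0$ and $(w_i,z_i)\in\Gamma$,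 $i=0,\dots,I$, with $w_0=w_{I+1}=x$, $z_I=y$ and $\sum_{i=0}^I \big(d_L(w_{i+1},z_i)-d_L(w_i,z_i)\big)=0$. Let $$G=\{(x,y):\exists (w,z)\in\Gamma',\ d_L(w,x)+d_L(x,y)+d_L(y,z)=d_L(w,z)\},\qquad R=G\cup G^{-1}.$$ Let $\mathcal T$ (resp. $\mathcal T_e$) be the set of points $x$ for which there is $y\ne x$ with $(y,x)\in G$ and (resp. or) there is $y\neq x$ with $(x,y)\in G$. Let $\mathcal S\subset\mathcal T$ be a cross-section of the equivalence relation $R\cap(\mathcal T\times\mathcal T)$, and let $g$ be the ray map: for $y\in\mathcal S$, $g(y,t)$ is the point $x$ with $(y,x)\in G$ and $d_L(x,y)=t$ if $t\ge0$, and the point $x$ with $(x,y)\in G$ and $d_L(x,y)=-t$ if $t<0$, where such a point exists. For $A\subset\mathcal T_e$ and $t\in\mathbb R$ put $A_t=g\big(g^{-1}(A)+(0,t)\big)$. The *absolute continuity assumption* on $\mu$ is: for every Borel set $A\subset\mathcal T_e$, $$\mu(A)>0\ \Longrightarrow\ \int_0^{+\infty}\mu(A_t)\,dt>0 .$$ **Proposition.**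 The following are equivalent: (i) $\mu$ satisfies the absolute continuity assumption; (ii) for every Borel set $A\subset\mathcal T_e$ the function $t\mapsto\mu(A_t)$ is continuous on $\mathbb R$; (iii) for every Borel set $A\subset\mathcal T_e$ the function $t\mapsto\mu(A_t)$ is continuous on $[0,+\infty)$. Moreover, if these conditions hold and the Borel set $A\subset\mathcal T_e$ is geodesically convex (for all $x,y\in A$, $A$ contains every minimizing $d_L$-geodesic from $x$ to $y$), then $t\mapsto\mu(A_t)$ is absolutely continuous on $\mathbb R$. -/

import Mathlib

open MeasureTheory Set
open scoped ENNReal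

namespace GeodesicTransport

/-- A unit speed geodesic of the extended metric `dL`, parametrized on an arbitrary
(possibly open, half-open or unbounded) interval `I ⊆ ℝ`. -/
def IsGeodesicOn {X : Type*} (dL : X → X → ℝ≥0∞) (I : Set ℝ) (γ : ℝ → X) : Prop :=
  I.OrdConnected ∧ ∀ s ∈ I, ∀ t ∈ I, dL (γ s) (γ t) = ENNReal.ofReal |s - t|

/-- The geodesic structure `(X, d, dL)`: `(X, d)` is a Polish metric space (`d` is the metric
carried by `X`), and `dL` is a second, `[0, ∞]`-valued, Borel distance for which `X` is a
non-branching geodesic space whose geodesics are `d`-continuous and locally `d`-compact. -/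
structure IsGeodesicStructure (X : Type*) [MetricSpace X] [PolishSpace X] [MeasurableSpace X]
    [BorelSpace X] (dL : X → X → ℝ≥0∞) : Prop where
  eq_zero_iff : ∀ x y, dL x y = 0 ↔ x = y
  symm : ∀ x y, dL x y = dL y x
  triangle : ∀ x y z, dL x z ≤ dL x y + dL y z
  borel : Measurable (fun p : X × X => dL p.1 p.2)
  /-- points at finite distance are joined by a geodesic -/
  geodesic : ∀ x y, dL x y ≠ ∞ → ∃ γ : ℝ → X,
    IsGeodesicOn dL (Icc 0 (dL x y).toReal) γ ∧ γ 0 = x ∧ γ (dL x y).toReal = y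
  /-- two geodesics that have a nontrivial initial piece in common do not bifurcate -/
  nonBranching : ∀ (γ₁ γ₂ : ℝ → X) (a b c : ℝ), a < b → b ≤ c →
    IsGeodesicOn dL (Icc a c) γ₁ → IsGeodesicOn dL (Icc a c) γ₂ →
    EqOn γ₁ γ₂ (Icc a b) → EqOn γ₁ γ₂ (Icc a c)
  continuous_geodesic : ∀ (I : Set ℝ) (γ : ℝ → X), IsGeodesicOn dL I γ → ContinuousOn γ I
  locallyCompact_geodesic : ∀ (I : Set ℝ) (γ : ℝ → X), IsGeodesicOn dL I γ →
    ∀ x ∈ γ '' I, ∃ r > 0, IsCompact (I ∩ γ ⁻¹' Metric.closedBall x r)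

/-- `c`-cyclical monotonicity of `Γ`; addition in `Fin (n + 1)` is cyclic. -/
def IsCyclicallyMonotone {X : Type*} (c : X → X → ℝ≥0∞) (Γ : Set (X × X)) : Prop :=
  ∀ (n : ℕ) (x y : Fin (n + 1) → X), (∀ i, (x i, y i) ∈ Γ) →
    ∑ i, c (x i) (y i) ≤ ∑ i, c (x (i + 1)) (y i)

/-- `π` is a transference plan from `μ` to `ν` with finite `dL`-cost, which is concentrated on the
`dL`-cyclically monotone set `Γ`; `Γ` is the union of an increasing sequence of compact sets
on each of which `dL` is continuous, and `dL` is finite on `Γ`. -/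
structure IsMonotonePlan {X : Type*} [MetricSpace X] [PolishSpace X] [MeasurableSpace X]
    [BorelSpace X] (dL : X → X → ℝ≥0∞) (μ ν : Measure X) (π : Measure (X × X))
    (Γ : Set (X × X)) : Prop where
  fst_eq : π.map Prod.fst = μ
  snd_eq : π.map Prod.snd = ν
  finite_cost : ∫⁻ p, dL p.1 p.2 ∂π ≠ ∞
  concentrated : π Γᶜ = 0
  monotone : IsCyclicallyMonotone dL Γ
  finite_dist : ∀ p ∈ Γ, dL p.1 p.2 ≠ ∞
  sigmaCompact : ∃ K : ℕ → Set (X × X), Monotone K ∧ (∀ n, IsCompact (K n)) ∧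
    (∀ n, ContinuousOn (fun p : X × X => dL p.1 p.2) (K n)) ∧ ⋃ n, K n = Γ

/-- The set `Γ'`: pairs `(x, y)` such that `x` is the first and `y` the last point of a chain in
`Γ` which closes up to a cycle of total cost `0`. -/
def cycleClosure {X : Type*} (dL : X → X → ℝ≥0∞) (Γ : Set (X × X)) : Set (X × X) :=
  {p | ∃ (n : ℕ) (w z : Fin (n + 1) → X), (∀ i, (w i, z i) ∈ Γ) ∧
    w 0 = p.1 ∧ z (Fin.last n) = p.2 ∧ ∑ i, dL (w (i + 1)) (z i) = ∑ i, dL (w i) (z i)}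

/-- The set `G` of oriented transport rays. -/
def orientedRays {X : Type*} (dL : X → X → ℝ≥0∞) (Γ : Set (X × X)) : Set (X × X) :=
  {p | ∃ q ∈ cycleClosure dL Γ, dL q.1 p.1 + dL p.1 p.2 + dL p.2 q.2 = dL q.1 q.2}

/-- The set `R = G ∪ G⁻¹` of transport rays. -/
def rays {X : Type*} (dL : X → X → ℝ≥0∞) (Γ : Set (X × X)) : Set (X × X) :=
  {p | (p.1, p.2) ∈ orientedRays dL Γ ∨ (p.2, p.1) ∈ orientedRays dL Γ}

/-- The transport set `𝒯` without end points. -/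
def transportSet {X : Type*} (dL : X → X → ℝ≥0∞) (Γ : Set (X × X)) : Set X :=
  {x | (∃ y, (y, x) ∈ orientedRays dL Γ ∧ x ≠ y) ∧ ∃ y, (x, y) ∈ orientedRays dL Γ ∧ x ≠ y}

/-- The transport set `𝒯ₑ` with end points. -/
def transportSetE {X : Type*} (dL : X → X → ℝ≥0∞) (Γ : Set (X × X)) : Set X :=
  {x | (∃ y, (y, x) ∈ orientedRays dL Γ ∧ x ≠ y) ∨ ∃ y, (x, y) ∈ orientedRays dL Γ ∧ x ≠ y}

/-- `S` is a cross-section of the ray equivalence relation `R ∩ (𝒯 × 𝒯)` on `𝒯`. -/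
def IsCrossSection {X : Type*} (dL : X → X → ℝ≥0∞) (Γ : Set (X × X)) (S : Set X) : Prop :=
  S ⊆ transportSet dL Γ ∧ ∀ x ∈ transportSet dL Γ, ∃! y, y ∈ S ∧ (x, y) ∈ rays dL Γ

/-- The (graph of the) ray map `g`, which parametrizes by signed arc length the ray through
each point `y` of the cross-section `S`. -/
def rayMap {X : Type*} (dL : X → X → ℝ≥0∞) (Γ : Set (X × X)) (S : Set X) :
    Set ((X × ℝ) × X) :=
  {p | p.1.1 ∈ S ∧ 0 ≤ p.1.2 ∧ (p.1.1, p.2) ∈ orientedRays dL Γ ∧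
      dL p.2 p.1.1 = ENNReal.ofReal p.1.2} ∪
  {p | p.1.1 ∈ S ∧ p.1.2 < 0 ∧ (p.2, p.1.1) ∈ orientedRays dL Γ ∧
      dL p.2 p.1.1 = ENNReal.ofReal (-p.1.2)}

/-- The `t`-evolution `A_t = g (g⁻¹(A) + (0, t))` of `A` along the rays. -/
def evolution {X : Type*} (dL : X → X → ℝ≥0∞) (Γ : Set (X × X)) (S : Set X)
    (A : Set X) (t : ℝ) : Set X :=
  {x | ∃ (y : X) (τ : ℝ), (∃ z ∈ A, ((y, τ), z) ∈ rayMap dL Γ S) ∧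
    ((y, τ + t), x) ∈ rayMap dL Γ S}

/-- The absolute continuity assumption on `μ`. -/
def AbsContAssumption {X : Type*} [MeasurableSpace X] (dL : X → X → ℝ≥0∞)
    (Γ : Set (X × X)) (S : Set X) (μ : Measure X) : Prop :=
  ∀ A : Set X, MeasurableSet A → A ⊆ transportSetE dL Γ → 0 < μ A →
    0 < ∫⁻ t in Ioi (0 : ℝ), μ (evolution dL Γ S A t)

/-- `A` contains every minimizing geodesic between two of its points. -/
def IsGeodesicallyConvex {X : Type*} (dL : X → X → ℝ≥0∞) (A : Set X) : Prop :=
  ∀ (γ : ℝ → X) (a b : ℝ), a ≤ b → IsGeodesicOn dL (Icc a b) γ → γ a ∈ A → γ b ∈ A →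
    ∀ t ∈ Ioo a b, γ t ∈ A

/-- Absolute continuity of a function on the whole real line. -/
def IsAbsolutelyContinuous (f : ℝ → ℝ) : Prop :=
  ∀ ε > 0, ∃ δ > 0, ∀ (n : ℕ) (a b : Fin n → ℝ), (∀ i, a i ≤ b i) →
    (Pairwise fun i j => Disjoint (Ioo (a i) (b i)) (Ioo (a j) (b j))) →
    ∑ i, (b i - a i) < δ → ∑ i, |f (b i) - f (a i)| < ε

end GeodesicTransport

namespace GeodesicTransport

open Filter Topology

/-! No disintegration of `μ` along the rays is needed. Cyclical monotonicity makes rays concatenate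
(`orientedRays_trans`), and non-branching makes signed displacements add up through every point of
`𝒯` (`moves_add`). Hence `A_t` is the set of points reached from `A` by a displacement of signed
length `t`, whatever the cross-section (`evolution_eq`).

Assume absolute continuity. Final points of rays have empty forward evolution. The evolutions of a
set of initial points are disjoint inside `𝒯`, so all but countably many are null there. Thus `𝒯ₑ \
𝒯` is negligible (`measure_endpoints_eq_zero`). Next, send `(x, u)` to the point at signed length
`-u` from `x` (`backPoint`). If a subset of `𝒯` has null preimage in `{u > 0}`, Fubini gives `μ(B_t)
= 0` for almost every `t > 0`, so the subset is `μ`-null. By Radon-Nikodym `μ` on `𝒯` is therefore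
the image of a finite measure `m ≪ μ × Lebesgue` (`exists_lift`), and `μ(A_t)` is the `m`-measure of
a fixed set translated by `t` in the second variable (`exists_measure_evolution_eq`).

Continuity is then the `L¹`-continuity of translations. For convex `A` the slices of the translated
set are intervals, and at most two of a family of disjoint intervals have exactly one end in a given
interval; this gives absolute continuity. Conversely, since `A_0 = A`, continuity at `0` from the
right keeps `μ(A_t)` away from `0` for small `t > 0`.

The sets involved are projections of Borel sets, so the measure theory rests on the universal
measurability of analytic sets. -/

/-! ### Universal measurability of analytic sets. -/

/-- An open subset of the Baire space which contains a box `∏ [0, N i]` contains a cylinder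
around it. -/
theorem exists_cylinder_subset_of_box_subset {W : Set (ℕ → ℕ)} (hW : IsOpen W) (N : ℕ → ℕ)
    (h : {x : ℕ → ℕ | ∀ i, x i ≤ N i} ⊆ W) : ∃ k, {x : ℕ → ℕ | ∀ i < k, x i ≤ N i} ⊆ W := by
  by_contra! hcon
  have hcon' : ∀ k, ∃ x : ℕ → ℕ, (∀ i < k, x i ≤ N i) ∧ x ∉ W := fun k =>
    not_subset.1 (hcon k)
  choose x hx hxW using hcon'
  have hK : IsCompact {x : ℕ → ℕ | ∀ i, x i ≤ N i} := by
    have := isCompact_univ_pi (s := fun i => Iic (N i)) fun i => (finite_Iic (N i)).isCompact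
    convert this using 1
    ext y
    simp only [mem_ofPred_eq, mem_univ_pi, mem_Iic]
  -- Truncating `x k` at `N` puts it in the compact box without changing its first `k` coordinates,
  -- so both sequences have the same limits.
  obtain ⟨y, hy, φ, hφ, hlim⟩ := hK.tendsto_subseq
    (x := fun k i => min (x k i) (N i)) fun k i => min_le_right _ _
  have hlim' : Tendsto (fun k => x (φ k)) atTop (𝓝 y) := by
    rw [tendsto_pi_nhds] at hlim ⊢
    intro i
    refine (hlim i).congr' ?_
    filter_upwards [eventually_gt_atTop i] with k hk
    exact min_eq_left (hx (φ k) i (hk.trans_le (hφ.id_le k)))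
  obtain ⟨k, hk⟩ := (hlim'.eventually (hW.mem_nhds (h hy))).exists
  exact hxW _ hk

/-- Inner regularity of analytic sets with respect to compact sets. -/
theorem exists_isCompact_subset_of_analyticSet {α : Type*} [TopologicalSpace α] [T2Space α]
    [MeasurableSpace α] [OpensMeasurableSpace α] (μ : Measure α) [IsFiniteMeasure μ] {s : Set α}
    (hs : AnalyticSet s) {c : ℝ≥0∞} (hc : c < μ s) : ∃ K ⊆ s, IsCompact K ∧ c ≤ μ K := by
  rw [AnalyticSet] at hs
  rcases hs with rfl | ⟨f, hf, rfl⟩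
  · simp at hc
  let B : (ℕ → ℕ) → ℕ → Set (ℕ → ℕ) := fun N k => {x | ∀ i < k, x i ≤ N i}
  -- Coordinates are bounded one at a time while the measure of the image stays above `c`.
  -- Continuity from below along monotone unions needs no measurability of the images.
  have step : ∀ (T : Set (ℕ → ℕ)) (k : ℕ), c < μ (f '' T) →
      ∃ n, c < μ (f '' (T ∩ {x | x k ≤ n})) := by
    intro T k hT
    have hmono : Monotone fun n => f '' (T ∩ {x | x k ≤ n}) := fun a b hab =>
      image_mono (inter_subset_inter_right _ fun x (hx : x k ≤ a) => hx.trans hab)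
    have hU : f '' T = ⋃ n, f '' (T ∩ {x | x k ≤ n}) := by
      rw [← image_iUnion, ← inter_iUnion]
      congr 1
      refine (inter_eq_left.2 fun x _ => mem_iUnion.2 ⟨x k, Nat.le_refl (x k)⟩).symm
    rw [hU, hmono.measure_iUnion] at hT
    exact lt_iSup_iff.1 hT
  choose! nx hnx using step
  let T : ℕ → Set (ℕ → ℕ) := fun k => Nat.rec univ (fun k S => S ∩ {x | x k ≤ nx S k}) k
  have hT : ∀ k, c < μ (f '' T k) := by
    intro k
    induction k with
    | zero => simpa [T] using hc
    | succ k ih => exact hnx _ k ih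
  let N : ℕ → ℕ := fun k => nx (T k) k
  have hTB : ∀ k, T k = {x | ∀ i < k, x i ≤ N i} := by
    intro k
    induction k with
    | zero => simp [T]
    | succ k ih =>
      have : T (k + 1) = T k ∩ {x | x k ≤ N k} := rfl
      rw [this, ih]
      ext x
      simp only [mem_inter_iff, mem_ofPred_eq, Nat.lt_succ_iff_lt_or_eq]
      constructor
      · rintro ⟨h1, h2⟩ i (hi | rfl)
        exacts [h1 i hi, h2]
      · exact fun h => ⟨fun i hi => h i (Or.inl hi), h k (Or.inr rfl)⟩
  have hbox : IsCompact {x : ℕ → ℕ | ∀ i, x i ≤ N i} := by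
    have := isCompact_univ_pi (s := fun i => Iic (N i)) fun i => (finite_Iic (N i)).isCompact
    convert this using 1
    ext y
    simp only [mem_ofPred_eq, mem_univ_pi, mem_Iic]
  have hK := hbox.image hf
  refine ⟨_, image_subset_range _ _, hK, ?_⟩
  -- Continuity from above does need measurable sets, hence the closures. Their intersection is no
  -- larger than the image of the box: an open set separating that image from a point already
  -- contains some `f '' T k`.
  have hanti : Antitone fun k => closure (f '' T k) := by
    refine antitone_nat_of_succ_le fun k => closure_mono (image_mono ?_)
    exact inter_subset_left
  have hinter : ⋂ k, closure (f '' T k) ⊆ f '' {x | ∀ i, x i ≤ N i} := by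
    intro y hy
    by_contra hyK
    obtain ⟨U, V, hU, hV, hKU, hyV, hd⟩ :=
      SeparatedNhds.of_isCompact_isCompact hK (isCompact_singleton (x := y))
        (disjoint_singleton_right.2 hyK)
    obtain ⟨k, hk⟩ := exists_cylinder_subset_of_box_subset (hU.preimage hf) N
      (image_subset_iff.1 hKU)
    have hyk := mem_iInter.1 hy k
    rw [hTB] at hyk
    obtain ⟨z, hzV, hz⟩ := mem_closure_iff.1 hyk V hV (hyV rfl)
    exact hd.le_bot ⟨image_subset_iff.2 hk hz, hzV⟩
  refine le_trans ?_ (measure_mono hinter)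
  rw [hanti.measure_iInter (fun k => isClosed_closure.measurableSet.nullMeasurableSet)
    ⟨0, measure_ne_top _ _⟩]
  exact le_iInf fun k => (hT k).le.trans (measure_mono subset_closure)

/-- Analytic sets are universally measurable. -/
theorem nullMeasurableSet_of_analyticSet {α : Type*} [TopologicalSpace α] [T2Space α]
    [MeasurableSpace α] [OpensMeasurableSpace α] (μ : Measure α) [SFinite μ] {s : Set α}
    (hs : AnalyticSet s) : NullMeasurableSet s μ := by
  refine NullMeasurableSet.mono_ac ?_ (absolutelyContinuous_toFinite μ)
  set m := μ.toFinite
  have h : ∀ n : ℕ, ∃ K ⊆ s, IsCompact K ∧ m s - (n + 1 : ℝ≥0∞)⁻¹ ≤ m K := by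
    intro n
    by_cases h0 : m s = 0
    · exact ⟨∅, empty_subset _, isCompact_empty, by simp [h0]⟩
    · exact exists_isCompact_subset_of_analyticSet m hs
        (ENNReal.sub_lt_self (measure_ne_top _ _) h0 (by simp))
  choose K hKs hK hmK using h
  have hU : MeasurableSet (⋃ n, K n) := .iUnion fun n => (hK n).measurableSet
  have hle : m s ≤ m (⋃ n, K n) := by
    have hlim : Tendsto (fun n : ℕ => m s - (n + 1 : ℝ≥0∞)⁻¹) atTop (𝓝 (m s - 0)) := by
      refine ENNReal.Tendsto.sub tendsto_const_nhds ?_ (Or.inl (measure_ne_top _ _))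
      have := (tendsto_add_atTop_iff_nat 1).2 ENNReal.tendsto_inv_nat_nhds_zero
      simpa using this
    rw [tsub_zero] at hlim
    exact le_of_tendsto' hlim fun n => (hmK n).trans (measure_mono (subset_iUnion _ _))
  exact hU.nullMeasurableSet.congr
    (ae_eq_of_subset_of_measure_ge (iUnion_subset hKs) hle hU.nullMeasurableSet
      (measure_ne_top _ _))

/-- A null measurable set of positive measure contains a measurable set of positive measure. -/
theorem measure_eq_zero_of_forall_measurable_subset {α : Type*} [MeasurableSpace α]
    {μ : Measure α} {s : Set α} (hs : NullMeasurableSet s μ)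
    (h : ∀ t ⊆ s, MeasurableSet t → μ t = 0) : μ s = 0 := by
  obtain ⟨t, hts, ht, hst⟩ := hs.exists_measurable_subset_ae_eq
  rw [← measure_congr hst, h t hts ht]

/-! ### Continuity of translations in measure. -/

/-- Translation is continuous in measure on the line. -/
theorem continuous_measure_translate (ρ : Measure ℝ) [IsFiniteMeasure ρ] (hρ : ρ ≪ volume)
    {C : Set ℝ} (hC : MeasurableSet C) : Continuous fun t => ρ ((fun u => u + t) ⁻¹' C) := by
  have hint : Integrable (fun u => (ρ.rnDeriv volume u).toReal) := Measure.integrable_toReal_rnDeriv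
  let F : Lp ℝ 1 (volume : Measure ℝ) := hint.toL1 _
  let τ : ℝ → C(ℝ, ℝ) := fun t => ⟨fun v => v - t, by fun_prop⟩
  have hτ : Continuous τ := ContinuousMap.continuous_of_continuous_uncurry _ (by
    show Continuous fun p : ℝ × ℝ => p.2 - p.1
    fun_prop)
  have hmp : ∀ t, MeasurePreserving (τ t) volume volume := fun t =>
    measurePreserving_sub_right volume t
  have hcont : Continuous fun t => ∫ v in C, Lp.compMeasurePreserving (τ t) (hmp t) F v :=
    (continuous_setIntegral C).comp
      ((continuous_const (y := F)).compMeasurePreservingLp hτ hmp ENNReal.one_ne_top)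
  -- With `h` the density of `ρ`, the substitution `v = u + t` turns `ρ (C - t)` into the integral
  -- of `h (v - t)` over the fixed set `C`.
  have key : ∀ t, ∫ v in C, Lp.compMeasurePreserving (τ t) (hmp t) F v =
      ρ.real ((fun u => u + t) ⁻¹' C) := by
    intro t
    have h1 : ∀ᵐ v, Lp.compMeasurePreserving (τ t) (hmp t) F v =
        (ρ.rnDeriv volume (v - t)).toReal :=
      (Lp.coeFn_compMeasurePreserving F (hmp t)).trans
        ((hmp t).quasiMeasurePreserving.ae_eq_comp hint.coeFn_toL1)
    rw [setIntegral_congr_ae hC (h1.mono fun v hv _ => hv)]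
    have h2 := (measurePreserving_add_right (volume : Measure ℝ) t).setIntegral_preimage_emb
      (MeasurableEquiv.addRight t).measurableEmbedding
      (fun v => (ρ.rnDeriv volume (v - t)).toReal) C
    rw [← h2]
    simp only [add_sub_cancel_right]
    exact Measure.setIntegral_toReal_rnDeriv hρ _
  have hreal : Continuous fun t => ρ.real ((fun u => u + t) ⁻¹' C) := by
    simpa only [key] using hcont
  refine (ENNReal.continuous_ofReal.comp hreal).congr fun t => ?_
  exact ofReal_measureReal

section

variable {X : Type*} [MeasurableSpace X]

theorem measurePreserving_translate_snd (μ : Measure X) [SFinite μ] (t : ℝ) :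
    MeasurePreserving (fun p : X × ℝ => (p.1, p.2 + t)) (μ.prod volume) (μ.prod volume) :=
  (MeasurePreserving.id μ).prod (measurePreserving_add_right volume t)

/-- Translation in the second variable is continuous with respect to a finite measure which is
absolutely continuous. -/
theorem continuous_measure_translate_snd {μ : Measure X} [IsFiniteMeasure μ] {m : Measure (X × ℝ)}
    [IsFiniteMeasure m] (hm : m ≪ μ.prod volume) {C : Set (X × ℝ)}
    (hC : NullMeasurableSet C (μ.prod volume)) :
    Continuous fun t => m {p | (p.1, p.2 + t) ∈ C} := by
  obtain ⟨C', hC', hCC'⟩ : ∃ C', MeasurableSet C' ∧ C' =ᵐ[μ.prod volume] C :=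
    ⟨_, measurableSet_toMeasurable _ _, hC.toMeasurable_ae_eq⟩
  have hcongr : ∀ t, m {p | (p.1, p.2 + t) ∈ C} = m {p | (p.1, p.2 + t) ∈ C'} := fun t =>
    measure_congr (hm.ae_le
      ((measurePreserving_translate_snd μ t).quasiMeasurePreserving.preimage_ae_eq hCC'.symm))
  simp_rw [hcongr]
  set h := m.rnDeriv (μ.prod volume) with hh
  have hhm : Measurable h := Measure.measurable_rnDeriv _ _
  have hfin : ∫⁻ x, ∫⁻ u, h (x, u) ∂volume ∂μ ≠ ∞ := by
    rw [← lintegral_prod _ hhm.aemeasurable, Measure.lintegral_rnDeriv hm]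
    exact measure_ne_top _ _
  have hsec : Measurable fun x => ∫⁻ u, h (x, u) := hhm.lintegral_prod_right'
  have hmeas : ∀ t, MeasurableSet {p : X × ℝ | (p.1, p.2 + t) ∈ C'} := fun t =>
    (measurePreserving_translate_snd μ t).measurable hC'
  have hslice : ∀ (t : ℝ) (x : X), MeasurableSet {u : ℝ | (x, u + t) ∈ C'} := fun t x =>
    measurable_prodMk_left (hmeas t)
  have hform : ∀ t, m {p | (p.1, p.2 + t) ∈ C'} =
      ∫⁻ x, (volume.withDensity fun u => h (x, u)) {u | (x, u + t) ∈ C'} ∂μ := by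
    intro t
    rw [← Measure.setLIntegral_rnDeriv hm, ← lintegral_indicator (hmeas t),
      lintegral_prod _ ((hhm.indicator (hmeas t)).aemeasurable)]
    refine lintegral_congr fun x => ?_
    rw [withDensity_apply _ (hslice t x), ← lintegral_indicator (hslice t x)]
    rfl
  simp_rw [hform]
  refine continuous_iff_continuousAt.2 fun t₀ => ?_
  -- Slice by slice this is the one-dimensional statement; the total mass of each slice dominates
  -- uniformly in `t`.
  refine tendsto_lintegral_filter_of_dominated_convergence (fun x => ∫⁻ u, h (x, u)) ?_ ?_ hfin ?_
  · refine Eventually.of_forall fun t => ?_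
    have : Measurable fun x => ∫⁻ u, ({p : X × ℝ | (p.1, p.2 + t) ∈ C'}.indicator h) (x, u) :=
      (hhm.indicator (hmeas t)).lintegral_prod_right'
    convert this using 1
    funext x
    rw [withDensity_apply _ (hslice t x), ← lintegral_indicator (hslice t x)]
    rfl
  · refine Eventually.of_forall fun t => Eventually.of_forall fun x => ?_
    refine (measure_mono (subset_univ _)).trans ?_
    rw [withDensity_apply _ MeasurableSet.univ, setLIntegral_univ]
  · filter_upwards [ae_lt_top hsec hfin] with x hx
    have : IsFiniteMeasure (volume.withDensity fun u => h (x, u)) :=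
      isFiniteMeasure_withDensity hx.ne
    exact (continuous_measure_translate _ (withDensity_absolutelyContinuous _ _)
      (C := {u | (x, u) ∈ C'}) (measurable_prodMk_left hC')).tendsto t₀

/-! ### Translations of sets with interval slices. -/

/-- The set of `u` such that exactly one of `u + a`, `u + b` belongs to an interval. -/
theorem volume_xor_translate_le {I : Set ℝ} (hI : I.OrdConnected) {a b : ℝ} (hab : a ≤ b) :
    volume {u : ℝ | Xor (u + a ∈ I) (u + b ∈ I)} ≤ ENNReal.ofReal (2 * (b - a)) := by
  -- Each one-sided difference has diameter at most `b - a`: were two of its points further apart,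
  -- the excluded translate of one would lie between two points of `I`.
  have key : ∀ s : Set ℝ, (∀ u ∈ s, ∀ v ∈ s, u < v → v - u ≤ b - a) →
      volume s ≤ ENNReal.ofReal (b - a) := by
    intro s hs
    refine (Real.volume_le_diam s).trans (Metric.ediam_le fun u hu v hv => ?_)
    rw [edist_dist, Real.dist_eq]
    refine ENNReal.ofReal_le_ofReal ?_
    rcases lt_trichotomy u v with h | rfl | h
    · rw [abs_sub_comm, abs_of_pos (sub_pos.2 h)]
      exact hs u hu v hv h
    · simpa using hab
    · rw [abs_of_pos (sub_pos.2 h)]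
      exact hs v hv u hu h
  have hsub : {u : ℝ | Xor (u + a ∈ I) (u + b ∈ I)} ⊆
      {u | u + a ∈ I ∧ u + b ∉ I} ∪ {u | u + b ∈ I ∧ u + a ∉ I} := fun u hu => hu
  refine (measure_mono hsub).trans ((measure_union_le _ _).trans ?_)
  rw [two_mul, ENNReal.ofReal_add (by linarith) (by linarith)]
  refine add_le_add (key _ ?_) (key _ ?_)
  · rintro u ⟨hu, hu'⟩ v ⟨hv, -⟩ huv
    by_contra! hlt
    exact hu' (hI.out hu hv ⟨by linarith, by linarith⟩)
  · rintro u ⟨hu, -⟩ v ⟨hv, hv'⟩ huv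
    by_contra! hlt
    exact hv' (hI.out hu hv ⟨by linarith, by linarith⟩)

/-- At most two members of a family of disjoint intervals have exactly one end point in a given
order connected set. -/
theorem card_xor_le_two {ι : Type*} [Fintype ι] {I : Set ℝ} (hI : I.OrdConnected) {a b : ι → ℝ}
    (hab : ∀ i, a i ≤ b i)
    (hd : Pairwise fun i j => Disjoint (Ioo (a i) (b i)) (Ioo (a j) (b j)))
    (s : Finset ι) (hs : ∀ i ∈ s, Xor (a i ∈ I) (b i ∈ I)) : s.card ≤ 2 := by
  by_contra! hcard
  obtain ⟨i, hi, j, hj, k, hk, hij, hik, hjk⟩ := Finset.two_lt_card.1 hcard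
  have hlt : ∀ i ∈ s, a i < b i := by
    intro i hi
    refine lt_of_le_of_ne (hab i) fun h => ?_
    have := hs i hi
    rw [h] at this
    simp [Xor] at this
  have hord : ∀ i ∈ s, ∀ j ∈ s, i ≠ j → b i ≤ a j ∨ b j ≤ a i := by
    intro i hi j hj hij
    have : Disjoint (Ioo (a i) (b i)) (Ioo (a j) (b j)) := hd hij
    rw [Ioo_disjoint_Ioo] at this
    have h1 := hlt i hi
    have h2 := hlt j hj
    rcases min_le_iff.1 this with h | h <;> rcases le_max_iff.1 h with h | h
    · linarith
    · exact Or.inl h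
    · exact Or.inr h
    · linarith
  have hmem : ∀ i ∈ s, ∃ c ∈ I, a i ≤ c ∧ c ≤ b i := by
    intro i hi
    rcases hs i hi with h | h
    · exact ⟨_, h.1, le_rfl, hab i⟩
    · exact ⟨_, h.1, hab i, le_rfl⟩
  -- The outer two intervals each contain a point of `I` up to their ends, so both ends of the
  -- middle one belong to `I`.
  have no3 : ∀ i ∈ s, ∀ j ∈ s, ∀ k ∈ s, b i ≤ a j → b j ≤ a k → False := by
    intro i hi j hj k hk h1 h2
    obtain ⟨c, hc, hc1, hc2⟩ := hmem i hi
    obtain ⟨e, he, he1, he2⟩ := hmem k hk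
    have hj' := hab j
    have ha : a j ∈ I := hI.out hc he ⟨by linarith, by linarith⟩
    have hb : b j ∈ I := hI.out hc he ⟨by linarith, by linarith⟩
    have := hs j hj
    simp [Xor, ha, hb] at this
  rcases hord i hi j hj hij with h1 | h1 <;> rcases hord j hj k hk hjk with h2 | h2 <;>
    rcases hord i hi k hk hik with h3 | h3
  · exact no3 i hi j hj k hk h1 h2
  · exact no3 i hi j hj k hk h1 h2
  · exact no3 i hi k hk j hj h3 h2
  · exact no3 k hk i hi j hj h3 h1
  · exact no3 j hj i hi k hk h1 h3
  · exact no3 j hj k hk i hi h2 h3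
  · exact no3 k hk j hj i hi h2 h1
  · exact no3 k hk j hj i hi h2 h1

/-- The measure of a null measurable set of a product is controlled by that of its slices. -/
theorem measure_prod_le_of_slice_le {Y : Type*} [MeasurableSpace Y] {μ : Measure X} [SFinite μ]
    {κ : Measure Y} [SFinite κ] {W : Set (X × Y)} (hW : NullMeasurableSet W (μ.prod κ)) {c : ℝ≥0∞}
    (h : ∀ x, κ (Prod.mk x ⁻¹' W) ≤ c) : μ.prod κ W ≤ c * μ univ := by
  obtain ⟨W', hsub, hW', hWW'⟩ := hW.exists_measurable_subset_ae_eq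
  rw [← measure_congr hWW', Measure.prod_apply hW', ← lintegral_const]
  exact lintegral_mono fun x => (measure_mono (preimage_mono hsub)).trans (h x)

theorem abs_measureReal_sub_le {Y : Type*} [MeasurableSpace Y] (m : Measure Y) [IsFiniteMeasure m]
    (A B : Set Y) : |m.real A - m.real B| ≤ m.real {y | Xor (y ∈ A) (y ∈ B)} := by
  have h : ∀ A B : Set Y, m.real A ≤ m.real B + m.real {y | Xor (y ∈ A) (y ∈ B)} := by
    intro A B
    refine (measureReal_mono ?_).trans (measureReal_union_le _ _)
    intro y hy
    by_cases hB : y ∈ B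
    · exact Or.inl hB
    · exact Or.inr (Or.inl ⟨hy, hB⟩)
  rw [abs_le]
  have h1 := h A B
  have h2 := h B A
  have h3 : {y | Xor (y ∈ B) (y ∈ A)} = {y | Xor (y ∈ A) (y ∈ B)} := by
    ext y
    exact or_comm
  rw [h3] at h2
  constructor <;> linarith

/-- If all the slices of `C` are intervals, translation of `C` in the second variable is absolutely
continuous with respect to a finite absolutely continuous measure. -/
theorem isAbsolutelyContinuous_measure_translate_snd {μ : Measure X} [IsFiniteMeasure μ]
    {m : Measure (X × ℝ)} [IsFiniteMeasure m] (hm : m ≪ μ.prod volume) {C : Set (X × ℝ)}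
    (hC : NullMeasurableSet C (μ.prod volume)) (hI : ∀ x, {u | (x, u) ∈ C}.OrdConnected) :
    IsAbsolutelyContinuous fun t => m.real {p | (p.1, p.2 + t) ∈ C} := by
  intro ε hε
  -- Half of `ε`, because the sets `W i` below cover each point at most twice.
  obtain ⟨δ₀, hδ₀, hsmall⟩ := exists_pos_setLIntegral_lt_of_measure_lt
    (μ := μ.prod volume) (f := m.rnDeriv (μ.prod volume))
    (by rw [Measure.lintegral_rnDeriv hm]; exact measure_ne_top _ _)
    (ε := ENNReal.ofReal (ε / 2)) (by simpa using hε)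
  simp_rw [Measure.setLIntegral_rnDeriv hm] at hsmall
  obtain ⟨δ, hδ, hδδ₀⟩ : ∃ δ : ℝ, 0 < δ ∧ ENNReal.ofReal (2 * δ) * μ univ < δ₀ := by
    have hlim : Tendsto (fun δ : ℝ => ENNReal.ofReal (2 * δ) * μ univ) (𝓝[>] 0) (𝓝 0) := by
      have h1 : Tendsto (fun δ : ℝ => ENNReal.ofReal (2 * δ)) (𝓝 0) (𝓝 0) := by
        have : Continuous fun δ : ℝ => ENNReal.ofReal (2 * δ) :=
          ENNReal.continuous_ofReal.comp (by fun_prop)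
        simpa using this.tendsto 0
      have := ENNReal.Tendsto.mul_const h1 (Or.inr (measure_ne_top μ univ))
      rw [zero_mul] at this
      exact this.mono_left nhdsWithin_le_nhds
    obtain ⟨δ, h1, h2⟩ :=
      ((hlim.eventually (gt_mem_nhds hδ₀)).and self_mem_nhdsWithin).exists
    exact ⟨δ, h2, h1⟩
  refine ⟨δ, hδ, fun n a b hab hd hsum => ?_⟩
  let W : Fin n → Set (X × ℝ) := fun i =>
    {p | Xor ((p.1, p.2 + a i) ∈ C) ((p.1, p.2 + b i) ∈ C)}
  have hsh : ∀ t : ℝ, NullMeasurableSet {p : X × ℝ | (p.1, p.2 + t) ∈ C} (μ.prod volume) :=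
    fun t => hC.preimage (measurePreserving_translate_snd μ t).quasiMeasurePreserving
  have hW : ∀ i, NullMeasurableSet (W i) (μ.prod volume) := fun i =>
    ((hsh (a i)).diff (hsh (b i))).union ((hsh (b i)).diff (hsh (a i)))
  have hWvol : μ.prod volume (⋃ i, W i) < δ₀ := by
    calc μ.prod volume (⋃ i, W i) ≤ ∑ i, μ.prod volume (W i) := measure_iUnion_fintype_le _ _
      _ ≤ ∑ i, ENNReal.ofReal (2 * (b i - a i)) * μ univ :=
        Finset.sum_le_sum fun i _ => measure_prod_le_of_slice_le (hW i) fun x =>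
          volume_xor_translate_le (hI x) (hab i)
      _ = ENNReal.ofReal (2 * ∑ i, (b i - a i)) * μ univ := by
        rw [← Finset.sum_mul, Finset.mul_sum, ENNReal.ofReal_sum_of_nonneg]
        intro i _
        linarith [hab i]
      _ ≤ ENNReal.ofReal (2 * δ) * μ univ := by gcongr
      _ < δ₀ := hδδ₀
  have hmW : m (⋃ i, W i) < ENNReal.ofReal (ε / 2) := hsmall _ hWvol
  have hcount : ∑ i, m (W i) ≤ 2 * m (⋃ i, W i) := by
    have hWm : ∀ i, NullMeasurableSet (W i) m := fun i => (hW i).mono_ac hm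
    have h1 : ∀ i, m (W i) = ∫⁻ p, (W i).indicator (fun _ => 1) p ∂m := fun i => by
      rw [lintegral_indicator_const₀ (hWm i), one_mul]
    have h2 : 2 * m (⋃ i, W i) = ∫⁻ p, (⋃ i, W i).indicator (fun _ => 2) p ∂m := by
      rw [lintegral_indicator_const₀ (.iUnion hWm)]
    rw [h2]
    simp_rw [h1]
    rw [← lintegral_finsetSum' _ fun i _ => aemeasurable_const.indicator₀ (hWm i)]
    refine lintegral_mono fun p => ?_
    classical
    by_cases hp : p ∈ ⋃ i, W i
    · have hle := card_xor_le_two (hI p.1) (a := fun i => p.2 + a i) (b := fun i => p.2 + b i)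
        (fun i => by linarith [hab i]) (fun i j hij => by
          have : Disjoint (Ioo (a i) (b i)) (Ioo (a j) (b j)) := hd hij
          rw [Ioo_disjoint_Ioo] at this
          refine Ioo_disjoint_Ioo.2 ?_
          rwa [min_add_add_left, max_add_add_left, add_le_add_iff_left])
        (Finset.univ.filter fun i => p ∈ W i) (fun i hi => (Finset.mem_filter.1 hi).2)
      simp only [indicator_of_mem hp, indicator_apply]
      rw [Finset.sum_boole]
      exact_mod_cast hle
    · have : ∀ i, p ∉ W i := fun i hi => hp (mem_iUnion.2 ⟨i, hi⟩)
      simp [this]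
  calc ∑ i, |m.real {p | (p.1, p.2 + b i) ∈ C} - m.real {p | (p.1, p.2 + a i) ∈ C}|
      ≤ ∑ i, m.real (W i) := Finset.sum_le_sum fun i _ => by
        rw [abs_sub_comm]
        exact abs_measureReal_sub_le m _ _
    _ = (∑ i, m (W i)).toReal := (ENNReal.toReal_sum fun i _ => measure_ne_top _ _).symm
    _ ≤ (2 * m (⋃ i, W i)).toReal :=
        ENNReal.toReal_mono (ENNReal.mul_ne_top (by simp) (measure_ne_top _ _)) hcount
    _ = 2 * m.real (⋃ i, W i) := by simp [Measure.real]
    _ < ε := by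
        have : m.real (⋃ i, W i) < ε / 2 :=
          (ENNReal.lt_ofReal_iff_toReal_lt (measure_ne_top _ _)).1 hmW
        linarith

end

/-! ### Chains in `Γ` and cycles of zero cost. -/

/-- `Chain dL Γ x y a b`: some chain in `Γ` has first point `x` and last point `y`, total cost `a`,
and its consecutive cross terms have total cost `b`. -/
inductive Chain {X : Type*} (dL : X → X → ℝ≥0∞) (Γ : Set (X × X)) :
    X → X → ℝ≥0∞ → ℝ≥0∞ → Prop
  | single {x y : X} : (x, y) ∈ Γ → Chain dL Γ x y (dL x y) 0
  | cons {x y x' y' : X} {a b : ℝ≥0∞} : (x, y) ∈ Γ → Chain dL Γ x' y' a b →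
      Chain dL Γ x y' (dL x y + a) (dL x' y + b)

section Chain

variable {X : Type*} {dL : X → X → ℝ≥0∞} {Γ : Set (X × X)}

theorem Chain.append {x y x' y' : X} {a b a' b' : ℝ≥0∞} (h : Chain dL Γ x y a b)
    (h' : Chain dL Γ x' y' a' b') : Chain dL Γ x y' (a + a') (b + dL x' y + b') := by
  induction h with
  | single hxy =>
    rw [zero_add]
    exact .cons hxy h'
  | cons hxy _ ih =>
    rw [add_assoc, add_assoc, add_assoc]
    rw [← add_assoc (_ : ℝ≥0∞) _ b']
    exact .cons hxy ih

theorem Chain.ne_top {x y : X} {a b : ℝ≥0∞} (h : Chain dL Γ x y a b)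
    (hΓ : ∀ p ∈ Γ, dL p.1 p.2 ≠ ∞) : a ≠ ∞ := by
  induction h with
  | single hxy => exact hΓ _ hxy
  | cons hxy _ ih => exact ENNReal.add_ne_top.2 ⟨hΓ _ hxy, ih⟩

/-- The inductive form makes concatenation a plain induction; this translates it to and from indexed
families. -/
theorem chain_iff {x y : X} {a b : ℝ≥0∞} :
    Chain dL Γ x y a b ↔ ∃ (n : ℕ) (w z : Fin (n + 1) → X), (∀ i, (w i, z i) ∈ Γ) ∧
      w 0 = x ∧ z (Fin.last n) = y ∧ ∑ i, dL (w i) (z i) = a ∧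
      ∑ i : Fin n, dL (w i.succ) (z i.castSucc) = b := by
  constructor
  · intro h
    induction h with
    | @single x y hxy => exact ⟨0, fun _ => x, fun _ => y, by simpa using hxy, rfl, rfl, by simp⟩
    | @cons x y x' y' a b hxy _ ih =>
      obtain ⟨n, w, z, hwz, hw, hz, ha, hb⟩ := ih
      refine ⟨n + 1, Fin.cons x w, Fin.cons y z, ?_, rfl, ?_, ?_, ?_⟩
      · intro i
        refine Fin.cases ?_ (fun j => ?_) i
        · simpa using hxy
        · simpa using hwz j
      · rw [← Fin.succ_last, Fin.cons_succ, hz]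
      · rw [Fin.sum_univ_succ]
        simp [ha]
      · rw [Fin.sum_univ_succ]
        simp only [Fin.cons_succ, hw, Fin.castSucc_zero, Fin.cons_zero, ← Fin.succ_castSucc, hb]
  · rintro ⟨n, w, z, hwz, rfl, rfl, rfl, rfl⟩
    induction n with
    | zero =>
      simpa using Chain.single (dL := dL) (hwz 0)
    | succ n ih =>
      have := Chain.cons (hwz 0) (ih (fun i => w i.succ) (fun i => z i.succ) fun i => hwz i.succ)
      rw [Fin.sum_univ_succ,
        Fin.sum_univ_succ (f := fun i : Fin (n + 1) => dL (w i.succ) (z i.castSucc))]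
      exact this

theorem sum_cyclic {n : ℕ} (w z : Fin (n + 1) → X) :
    ∑ i, dL (w (i + 1)) (z i) =
      ∑ i : Fin n, dL (w i.succ) (z i.castSucc) + dL (w 0) (z (Fin.last n)) := by
  rw [Fin.sum_univ_castSucc, Fin.last_add_one]
  simp only [Fin.coeSucc_eq_succ]

/-- The cross term with index `n` wraps around to `w 0` and is the closing cost `dL x y`. Membership
is thus the equality case of `a ≤ b + dL x y`, which cyclical monotonicity gives for every chain. -/
theorem mem_cycleClosure_iff {x y : X} :
    (x, y) ∈ cycleClosure dL Γ ↔ ∃ a b, Chain dL Γ x y a b ∧ b + dL x y = a := by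
  constructor
  · rintro ⟨n, w, z, hwz, hw, hz, h⟩
    refine ⟨_, _, chain_iff.2 ⟨n, w, z, hwz, hw, hz, rfl, rfl⟩, ?_⟩
    rw [← h, sum_cyclic, hw, hz]
  · rintro ⟨a, b, hc, h⟩
    obtain ⟨n, w, z, hwz, hw, hz, ha, hb⟩ := chain_iff.1 hc
    refine ⟨n, w, z, hwz, hw, hz, ?_⟩
    rw [sum_cyclic, ha, hb, hw, hz, h]

theorem Chain.le_of_isCyclicallyMonotone (hΓ : IsCyclicallyMonotone dL Γ) {x y : X} {a b : ℝ≥0∞}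
    (h : Chain dL Γ x y a b) : a ≤ b + dL x y := by
  obtain ⟨n, w, z, hwz, rfl, rfl, rfl, rfl⟩ := chain_iff.1 h
  rw [← sum_cyclic]
  exact hΓ n w z hwz

theorem ne_top_of_mem_cycleClosure (hfin : ∀ p ∈ Γ, dL p.1 p.2 ≠ ∞) {x y : X}
    (h : (x, y) ∈ cycleClosure dL Γ) : dL x y ≠ ∞ := by
  obtain ⟨a, b, hc, hab⟩ := mem_cycleClosure_iff.1 h
  exact ne_top_of_le_ne_top (hc.ne_top hfin) (hab ▸ le_add_self)

/-- `cycleClosure dL Γ` is monotone along cycles of length two. -/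
theorem add_le_add_of_mem_cycleClosure (hΓ : IsCyclicallyMonotone dL Γ)
    (hfin : ∀ p ∈ Γ, dL p.1 p.2 ≠ ∞) {w v w' v' : X} (h : (w, v) ∈ cycleClosure dL Γ)
    (h' : (w', v') ∈ cycleClosure dL Γ) : dL w v + dL w' v' ≤ dL w' v + dL w v' := by
  obtain ⟨a, b, hc, hab⟩ := mem_cycleClosure_iff.1 h
  obtain ⟨a', b', hc', hab'⟩ := mem_cycleClosure_iff.1 h'
  have hb : b ≠ ∞ := ne_top_of_le_ne_top (hc.ne_top hfin) (hab ▸ le_self_add)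
  have hb' : b' ≠ ∞ := ne_top_of_le_ne_top (hc'.ne_top hfin) (hab' ▸ le_self_add)
  -- Concatenating the two chains produces the two mixed distances; the finite inner cross terms `b
  -- + b'` then cancel.
  have := (hc.append hc').le_of_isCyclicallyMonotone hΓ
  rw [← hab, ← hab'] at this
  refine (ENNReal.add_le_add_iff_left (ENNReal.add_ne_top.2 ⟨hb, hb'⟩)).1 ?_
  convert this using 1 <;> ring

theorem mem_cycleClosure_of_add_eq {w v w' v' : X}
    (h : (w, v) ∈ cycleClosure dL Γ) (h' : (w', v') ∈ cycleClosure dL Γ)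
    (heq : dL w' v + dL w v' = dL w v + dL w' v') : (w, v') ∈ cycleClosure dL Γ := by
  obtain ⟨a, b, hc, hab⟩ := mem_cycleClosure_iff.1 h
  obtain ⟨a', b', hc', hab'⟩ := mem_cycleClosure_iff.1 h'
  refine mem_cycleClosure_iff.2 ⟨_, _, hc.append hc', ?_⟩
  calc b + dL w' v + b' + dL w v' = b + b' + (dL w' v + dL w v') := by ring
    _ = b + b' + (dL w v + dL w' v') := by rw [heq]
    _ = (b + dL w v) + (b' + dL w' v') := by ring
    _ = a + a' := by rw [hab, hab']

theorem IsGeodesicOn.ne_top_and_toReal {γ : ℝ → X} {I : Set ℝ} (h : IsGeodesicOn dL I γ) {s t : ℝ}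
    (hs : s ∈ I) (ht : t ∈ I) (hst : s ≤ t) :
    dL (γ s) (γ t) ≠ ∞ ∧ (dL (γ s) (γ t)).toReal = t - s := by
  rw [h.2 s hs t ht, abs_sub_comm, abs_of_nonneg (by linarith)]
  exact ⟨ENNReal.ofReal_ne_top, ENNReal.toReal_ofReal (by linarith)⟩

end Chain

/-! ### Concatenation and prolongation of geodesics. -/

section Geometry

variable {X : Type*} [MetricSpace X] [PolishSpace X] [MeasurableSpace X] [BorelSpace X]
  {dL : X → X → ℝ≥0∞}

namespace IsGeodesicStructure

theorem toReal_comm (hX : IsGeodesicStructure X dL) (x y : X) :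
    (dL x y).toReal = (dL y x).toReal := by rw [hX.symm]

theorem self (hX : IsGeodesicStructure X dL) (x : X) : dL x x = 0 := (hX.eq_zero_iff x x).2 rfl

theorem ne_top_trans (hX : IsGeodesicStructure X dL) {x y z : X} (h : dL x y ≠ ∞)
    (h' : dL y z ≠ ∞) : dL x z ≠ ∞ :=
  ne_top_of_le_ne_top (ENNReal.add_ne_top.2 ⟨h, h'⟩) (hX.triangle x y z)

theorem toReal_triangle (hX : IsGeodesicStructure X dL) {x y z : X} (h : dL x y ≠ ∞)
    (h' : dL y z ≠ ∞) : (dL x z).toReal ≤ (dL x y).toReal + (dL y z).toReal := by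
  rw [← ENNReal.toReal_add h h']
  exact ENNReal.toReal_mono (ENNReal.add_ne_top.2 ⟨h, h'⟩) (hX.triangle x y z)

theorem eq_of_toReal_eq_zero (hX : IsGeodesicStructure X dL) {x y : X} (h : dL x y ≠ ∞)
    (h' : (dL x y).toReal = 0) : x = y :=
  (hX.eq_zero_iff x y).1 (((ENNReal.toReal_eq_zero_iff _).1 h').resolve_right h)

theorem toReal_pos (hX : IsGeodesicStructure X dL) {x y : X} (h : dL x y ≠ ∞)
    (h' : x ≠ y) : 0 < (dL x y).toReal :=
  lt_of_le_of_ne ENNReal.toReal_nonneg fun h0 => h' (hX.eq_of_toReal_eq_zero h h0.symm)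

/-- The concatenation of two aligned geodesics is a geodesic. -/
theorem exists_concat (hX : IsGeodesicStructure X dL) {γ₁ γ₂ : ℝ → X} {a b : ℝ} (ha : 0 ≤ a)
    (hb : 0 ≤ b) (h₁ : IsGeodesicOn dL (Icc 0 a) γ₁) (h₂ : IsGeodesicOn dL (Icc 0 b) γ₂)
    (h : γ₁ a = γ₂ 0) (hab : dL (γ₁ 0) (γ₂ b) = ENNReal.ofReal (a + b)) :
    ∃ γ : ℝ → X, IsGeodesicOn dL (Icc 0 (a + b)) γ ∧ (∀ t ∈ Icc 0 a, γ t = γ₁ t) ∧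
      ∀ t ∈ Icc 0 b, γ (a + t) = γ₂ t := by
  let γ : ℝ → X := fun t => if t ≤ a then γ₁ t else γ₂ (t - a)
  have hγ₁ : ∀ t ∈ Icc 0 a, γ t = γ₁ t := fun t ht => if_pos ht.2
  have hγ₂ : ∀ t ∈ Icc 0 b, γ (a + t) = γ₂ t := by
    intro t ht
    rcases ht.1.eq_or_lt with rfl | h0
    · rw [add_zero, hγ₁ a ⟨ha, le_rfl⟩, h]
    · show (if a + t ≤ a then _ else _) = _
      rw [if_neg (by linarith), add_sub_cancel_left]
  have hle : ∀ s ∈ Icc (0 : ℝ) (a + b), ∀ t ∈ Icc (0 : ℝ) (a + b), s ≤ t →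
      dL (γ s) (γ t) = ENNReal.ofReal (t - s) := by
    intro s hs t ht hst
    rcases le_total t a with hta | hta
    · rw [hγ₁ s ⟨hs.1, hst.trans hta⟩, hγ₁ t ⟨ht.1, hta⟩,
        h₁.2 s ⟨hs.1, hst.trans hta⟩ t ⟨ht.1, hta⟩, abs_sub_comm, abs_of_nonneg (by linarith)]
    rcases le_total a s with has | has
    · obtain ⟨s, rfl⟩ : ∃ s', s = a + s' := ⟨s - a, by ring⟩
      obtain ⟨t, rfl⟩ : ∃ t', t = a + t' := ⟨t - a, by ring⟩
      have hs' : s ∈ Icc 0 b := ⟨by linarith, by linarith [hs.2]⟩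
      have ht' : t ∈ Icc 0 b := ⟨by linarith, by linarith [ht.2]⟩
      rw [hγ₂ s hs', hγ₂ t ht', h₂.2 s hs' t ht', abs_sub_comm, abs_of_nonneg (by linarith)]
      congr 1
      ring
    · obtain ⟨t, rfl⟩ : ∃ t', t = a + t' := ⟨t - a, by ring⟩
      have ht' : t ∈ Icc 0 b := ⟨by linarith, by linarith [ht.2]⟩
      have hs' : s ∈ Icc 0 a := ⟨hs.1, has⟩
      rw [hγ₁ s hs', hγ₂ t ht']
      have e1 : dL (γ₁ 0) (γ₁ s) = ENNReal.ofReal s := by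
        rw [h₁.2 0 ⟨le_rfl, ha⟩ s hs', zero_sub, abs_neg, abs_of_nonneg hs.1]
      have e2 : dL (γ₁ s) (γ₁ a) = ENNReal.ofReal (a - s) := by
        rw [h₁.2 s hs' a ⟨ha, le_rfl⟩, abs_sub_comm, abs_of_nonneg (by linarith)]
      have e3 : dL (γ₂ 0) (γ₂ t) = ENNReal.ofReal t := by
        rw [h₂.2 0 ⟨le_rfl, hb⟩ t ht', zero_sub, abs_neg, abs_of_nonneg ht'.1]
      have e4 : dL (γ₂ t) (γ₂ b) = ENNReal.ofReal (b - t) := by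
        rw [h₂.2 t ht' b ⟨hb, le_rfl⟩, abs_sub_comm, abs_of_nonneg (by linarith [ht'.2])]
      refine le_antisymm ?_ ?_
      · refine (hX.triangle _ (γ₁ a) _).trans ?_
        rw [e2, h, e3, ← ENNReal.ofReal_add (by linarith) ht'.1]
        exact ENNReal.ofReal_le_ofReal (by linarith)
      -- A shortcut between the two pieces would make the end points closer than `a + b`.
      · have h3 := (hX.triangle (γ₁ 0) (γ₁ s) (γ₂ b)).trans
          (add_le_add_right (hX.triangle (γ₁ s) (γ₂ t) (γ₂ b)) _)
        rw [hab, e1, e4] at h3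
        have hsum : ENNReal.ofReal (a + b) =
            ENNReal.ofReal s + (ENNReal.ofReal (a + t - s) + ENNReal.ofReal (b - t)) := by
          rw [← ENNReal.ofReal_add (by linarith) (by linarith [ht'.2]),
            ← ENNReal.ofReal_add hs.1 (by linarith [ht'.2])]
          congr 1
          ring
        rw [hsum] at h3
        exact (ENNReal.add_le_add_iff_right ENNReal.ofReal_ne_top).1
          ((ENNReal.add_le_add_iff_left ENNReal.ofReal_ne_top).1 h3)
  refine ⟨γ, ⟨ordConnected_Icc, fun s hs t ht => ?_⟩, hγ₁, hγ₂⟩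
  rcases le_total s t with hst | hst
  · rw [hle s hs t ht hst, abs_sub_comm, abs_of_nonneg (by linarith)]
  · rw [hX.symm, hle t ht s hs hst, abs_of_nonneg (by linarith)]

/-- A geodesic through `p`, `x` and `y` when these points are aligned. -/
theorem exists_geodesic_through (hX : IsGeodesicStructure X dL) {p x y : X} (hpx : dL p x ≠ ∞)
    (hxy : dL x y ≠ ∞) (h : (dL p y).toReal = (dL p x).toReal + (dL x y).toReal)
    {γ₁ : ℝ → X} (hγ₁ : IsGeodesicOn dL (Icc 0 (dL p x).toReal) γ₁) (h0 : γ₁ 0 = p)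
    (h1 : γ₁ (dL p x).toReal = x) :
    ∃ γ : ℝ → X, IsGeodesicOn dL (Icc 0 ((dL p x).toReal + (dL x y).toReal)) γ ∧
      EqOn γ γ₁ (Icc 0 (dL p x).toReal) ∧ γ ((dL p x).toReal + (dL x y).toReal) = y := by
  obtain ⟨γ₂, hγ₂, h2, h3⟩ := hX.geodesic x y hxy
  obtain ⟨γ, hγ, e1, e2⟩ := hX.exists_concat ENNReal.toReal_nonneg ENNReal.toReal_nonneg hγ₁ hγ₂
    (h1.trans h2.symm) (by
      rw [h0, h3, ← h, ENNReal.ofReal_toReal (hX.ne_top_trans hpx hxy)])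
  refine ⟨γ, hγ, e1, ?_⟩
  rw [e2 _ ⟨ENNReal.toReal_nonneg, le_rfl⟩, h3]

/-- Two prolongations of the nontrivial geodesic from `p` to `x` are aligned. -/
theorem aligned_of_prolongation (hX : IsGeodesicStructure X dL) {p x y y' : X}
    (hpx : dL p x ≠ ∞) (hne : p ≠ x) (hxy : dL x y ≠ ∞) (hxy' : dL x y' ≠ ∞)
    (h : (dL p y).toReal = (dL p x).toReal + (dL x y).toReal)
    (h' : (dL p y').toReal = (dL p x).toReal + (dL x y').toReal)
    (hle : (dL x y).toReal ≤ (dL x y').toReal) :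
    dL y y' ≠ ∞ ∧ (dL x y').toReal = (dL x y).toReal + (dL y y').toReal := by
  obtain ⟨γ₀, hγ₀, h0, h1⟩ := hX.geodesic p x hpx
  obtain ⟨γ, hγ, e, ey⟩ := hX.exists_geodesic_through hpx hxy h hγ₀ h0 h1
  obtain ⟨γ', hγ', e', ey'⟩ := hX.exists_geodesic_through hpx hxy' h' hγ₀ h0 h1
  have hpos := hX.toReal_pos hpx hne
  have h0y : (0 : ℝ) ≤ (dL x y).toReal := ENNReal.toReal_nonneg
  have hsub : IsGeodesicOn dL (Icc 0 ((dL p x).toReal + (dL x y).toReal)) γ' :=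
    ⟨ordConnected_Icc, fun s hs t ht => hγ'.2 s ⟨hs.1, by linarith [hs.2]⟩ t
      ⟨ht.1, by linarith [ht.2]⟩⟩
  -- Both prolongations start with the same nontrivial piece `γ₀`, so the longer one passes through
  -- `y`.
  have heq := hX.nonBranching γ γ' 0 _ _ hpos (by linarith) hγ hsub (e.trans e'.symm)
  have hy : γ' ((dL p x).toReal + (dL x y).toReal) = y := by
    rw [← heq ⟨by linarith, le_rfl⟩, ey]
  have := hγ'.ne_top_and_toReal (s := (dL p x).toReal + (dL x y).toReal)
    (t := (dL p x).toReal + (dL x y').toReal) ⟨by linarith, by linarith⟩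
    ⟨by linarith, le_rfl⟩ (by linarith)
  rw [hy, ey'] at this
  exact ⟨this.1, by linarith [this.2]⟩

end IsGeodesicStructure

end Geometry

/-! ### Signed displacements along rays. -/

/-- `z` is reached from `x` by moving along a ray by the signed length `s`. -/
def Moves {X : Type*} (dL : X → X → ℝ≥0∞) (Γ : Set (X × X)) (s : ℝ) (x z : X) : Prop :=
  (0 ≤ s ∧ (x, z) ∈ orientedRays dL Γ ∧ dL x z = ENNReal.ofReal s) ∨
    (s ≤ 0 ∧ (z, x) ∈ orientedRays dL Γ ∧ dL z x = ENNReal.ofReal (-s))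

section Geometry

variable {X : Type*} {dL : X → X → ℝ≥0∞} {Γ : Set (X × X)}

theorem moves_neg {s : ℝ} {x z : X} : Moves dL Γ (-s) z x ↔ Moves dL Γ s x z := by
  unfold Moves
  rw [neg_nonneg, neg_nonpos, neg_neg]
  exact or_comm

theorem mem_orientedRays_iff (hfin : ∀ p ∈ Γ, dL p.1 p.2 ≠ ∞) {x y : X} :
    (x, y) ∈ orientedRays dL Γ ↔ ∃ w v, (w, v) ∈ cycleClosure dL Γ ∧ dL w x ≠ ∞ ∧
      dL x y ≠ ∞ ∧ dL y v ≠ ∞ ∧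
      (dL w x).toReal + (dL x y).toReal + (dL y v).toReal = (dL w v).toReal := by
  constructor
  · rintro ⟨⟨w, v⟩, hwv, h⟩
    have hne := ne_top_of_mem_cycleClosure hfin hwv
    simp only at h
    have h1 := hne
    rw [← h, ENNReal.add_ne_top, ENNReal.add_ne_top] at h1
    refine ⟨w, v, hwv, h1.1.1, h1.1.2, h1.2, ?_⟩
    rw [← h, ENNReal.toReal_add (ENNReal.add_ne_top.2 h1.1) h1.2,
      ENNReal.toReal_add h1.1.1 h1.1.2]
  · rintro ⟨w, v, hwv, h1, h2, h3, h⟩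
    refine ⟨(w, v), hwv, ?_⟩
    have hne := ne_top_of_mem_cycleClosure hfin hwv
    rw [← ENNReal.toReal_eq_toReal_iff' (by simp [h1, h2, h3]) hne,
      ENNReal.toReal_add (by simp [h1, h2]) h3, ENNReal.toReal_add h1 h2, h]

theorem ne_top_of_mem_orientedRays (hfin : ∀ p ∈ Γ, dL p.1 p.2 ≠ ∞) {x y : X}
    (h : (x, y) ∈ orientedRays dL Γ) : dL x y ≠ ∞ := by
  obtain ⟨w, v, -, -, h, -⟩ := (mem_orientedRays_iff hfin).1 h
  exact h

theorem mem_transportSetE_of_moves {s : ℝ} (hs : s ≠ 0) {x z : X} (h : Moves dL Γ s x z)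
    (hself : ∀ x, dL x x = 0) : x ∈ transportSetE dL Γ ∧ z ∈ transportSetE dL Γ := by
  rcases h with ⟨h0, h, hd⟩ | ⟨h0, h, hd⟩
  · have hne : x ≠ z := by
      rintro rfl
      rw [hself, eq_comm, ENNReal.ofReal_eq_zero] at hd
      exact hs (le_antisymm hd h0)
    exact ⟨Or.inr ⟨z, h, hne⟩, Or.inl ⟨x, h, hne.symm⟩⟩
  · have hne : x ≠ z := by
      rintro rfl
      rw [hself, eq_comm, ENNReal.ofReal_eq_zero] at hd
      exact hs (le_antisymm h0 (by linarith))
    exact ⟨Or.inl ⟨z, h, hne⟩, Or.inr ⟨x, h, hne.symm⟩⟩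

theorem moves_iff_toReal (hfin : ∀ p ∈ Γ, dL p.1 p.2 ≠ ∞) {s : ℝ} {x z : X} :
    Moves dL Γ s x z ↔
      (0 ≤ s ∧ (x, z) ∈ orientedRays dL Γ ∧ (dL x z).toReal = s) ∨
        (s ≤ 0 ∧ (z, x) ∈ orientedRays dL Γ ∧ (dL z x).toReal = -s) := by
  have key : ∀ {s : ℝ} {x z : X}, 0 ≤ s ∧ (x, z) ∈ orientedRays dL Γ ∧
      dL x z = ENNReal.ofReal s ↔
      0 ≤ s ∧ (x, z) ∈ orientedRays dL Γ ∧ (dL x z).toReal = s := by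
    intro s x z
    refine and_congr_right fun hs => and_congr_right fun h => ?_
    rw [← ENNReal.toReal_eq_toReal_iff' (ne_top_of_mem_orientedRays hfin h)
      ENNReal.ofReal_ne_top, ENNReal.toReal_ofReal hs]
  have h1 := key (s := s) (x := x) (z := z)
  have h2 := key (s := -s) (x := z) (z := x)
  rw [neg_nonneg] at h2
  exact or_congr h1 h2

theorem moves_of_mem (hfin : ∀ p ∈ Γ, dL p.1 p.2 ≠ ∞) {x z : X}
    (h : (x, z) ∈ orientedRays dL Γ) : Moves dL Γ (dL x z).toReal x z :=
  (moves_iff_toReal hfin).2 (Or.inl ⟨ENNReal.toReal_nonneg, h, rfl⟩)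

variable [MetricSpace X] [PolishSpace X] [MeasurableSpace X] [BorelSpace X]

namespace IsGeodesicStructure

/-- Points between two points of an oriented ray belong to the ray. -/
theorem mem_orientedRays_of_between (hX : IsGeodesicStructure X dL) (hfin : ∀ p ∈ Γ, dL p.1 p.2 ≠ ∞)
    {x y z : X}
    (h : (x, y) ∈ orientedRays dL Γ) (hxz : dL x z ≠ ∞) (hzy : dL z y ≠ ∞)
    (hz : (dL x y).toReal = (dL x z).toReal + (dL z y).toReal) :
    (x, z) ∈ orientedRays dL Γ ∧ (z, y) ∈ orientedRays dL Γ := by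
  obtain ⟨w, v, hwv, h1, h2, h3, h⟩ := (mem_orientedRays_iff hfin).1 h
  have hwz := hX.ne_top_trans h1 hxz
  have hzv := hX.ne_top_trans hzy h3
  have t1 := hX.toReal_triangle hzy h3
  have t2 := hX.toReal_triangle h1 hxz
  have t3 := hX.toReal_triangle hwz hzv
  exact ⟨(mem_orientedRays_iff hfin).2 ⟨w, v, hwv, h1, hxz, hzv, by linarith⟩,
    (mem_orientedRays_iff hfin).2 ⟨w, v, hwv, hwz, hzy, h3, by linarith⟩⟩

/-- Let `(w, v)` and `(w', v')` witness the two rays. Swapping their ends cannot lower the total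
cost by monotonicity, and cannot raise it by the triangle inequality, as both paths pass through
`y`. All inequalities are therefore equalities, and `(w, v')` witnesses the concatenated ray. -/
theorem orientedRays_trans (hX : IsGeodesicStructure X dL) (hΓ : IsCyclicallyMonotone dL Γ)
    (hfin : ∀ p ∈ Γ, dL p.1 p.2 ≠ ∞)
    {x y z : X} (h : (x, y) ∈ orientedRays dL Γ) (h' : (y, z) ∈ orientedRays dL Γ) :
    (x, z) ∈ orientedRays dL Γ ∧ (dL x z).toReal = (dL x y).toReal + (dL y z).toReal := by
  obtain ⟨w, v, hwv, h1, h2, h3, h⟩ := (mem_orientedRays_iff hfin).1 h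
  obtain ⟨w', v', hwv', h1', h2', h3', h'⟩ := (mem_orientedRays_iff hfin).1 h'
  have fxz := hX.ne_top_trans h2 h2'
  have fwv' := hX.ne_top_trans (hX.ne_top_trans h1 fxz) h3'
  have fw'v := hX.ne_top_trans h1' h3
  have fwv := ne_top_of_mem_cycleClosure hfin hwv
  have fwv2 := ne_top_of_mem_cycleClosure hfin hwv'
  have hmon := ENNReal.toReal_mono (ENNReal.add_ne_top.2 ⟨fw'v, fwv'⟩)
    (add_le_add_of_mem_cycleClosure hΓ hfin hwv hwv')
  rw [ENNReal.toReal_add fwv fwv2, ENNReal.toReal_add fw'v fwv'] at hmon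
  have t1 := hX.toReal_triangle h1' h3
  have t2 := hX.toReal_triangle (hX.ne_top_trans h1 fxz) h3'
  have t3 := hX.toReal_triangle h1 fxz
  have t4 := hX.toReal_triangle h2 h2'
  have hmem : (w, v') ∈ cycleClosure dL Γ := by
    refine mem_cycleClosure_of_add_eq hwv hwv' ?_
    rw [← ENNReal.toReal_eq_toReal_iff' (by simp [fw'v, fwv']) (by simp [fwv, fwv2]),
      ENNReal.toReal_add fwv fwv2, ENNReal.toReal_add fw'v fwv']
    linarith
  exact ⟨(mem_orientedRays_iff hfin).2 ⟨w, v', hmem, h1, fxz, h3', by linarith⟩, by linarith⟩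

theorem mem_of_moves (hX : IsGeodesicStructure X dL) (hfin : ∀ p ∈ Γ, dL p.1 p.2 ≠ ∞) {s : ℝ}
    (hs : 0 ≤ s) {x z : X}
    (h : Moves dL Γ s x z) : (x, z) ∈ orientedRays dL Γ ∧ (dL x z).toReal = s := by
  rcases (moves_iff_toReal hfin).1 h with h | h
  · exact h.2
  · obtain rfl : s = 0 := le_antisymm h.1 hs
    rw [neg_zero] at h
    have hzx := hX.eq_of_toReal_eq_zero (ne_top_of_mem_orientedRays hfin h.2.1) h.2.2
    subst hzx
    exact h.2

theorem eq_of_moves_zero (hX : IsGeodesicStructure X dL) (hfin : ∀ p ∈ Γ, dL p.1 p.2 ≠ ∞) {x z : X}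
    (h : Moves dL Γ 0 x z) : x = z := by
  obtain ⟨h, h'⟩ := hX.mem_of_moves hfin le_rfl h
  exact hX.eq_of_toReal_eq_zero (ne_top_of_mem_orientedRays hfin h) h'

/-- Read backwards, the geodesics from `q` to `x` and to `a` both prolong the nontrivial piece from
`q` to `z`, so `x` and `a` are aligned with `z`. -/
theorem moves_add_of_nonneg_of_nonpos (hX : IsGeodesicStructure X dL)
    (hΓ : IsCyclicallyMonotone dL Γ)
    (hfin : ∀ p ∈ Γ, dL p.1 p.2 ≠ ∞) {x z a q : X} (hzq : (z, q) ∈ orientedRays dL Γ)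
    (hne : z ≠ q) (hxz : (x, z) ∈ orientedRays dL Γ) (haz : (a, z) ∈ orientedRays dL Γ) :
    Moves dL Γ ((dL x z).toReal - (dL a z).toReal) x a := by
  have hle : ∀ x a : X, (x, z) ∈ orientedRays dL Γ → (a, z) ∈ orientedRays dL Γ →
      (dL a z).toReal ≤ (dL x z).toReal →
      Moves dL Γ ((dL x z).toReal - (dL a z).toReal) x a := by
    intro x a hxz haz hle
    have f1 := ne_top_of_mem_orientedRays hfin hxz
    have f2 := ne_top_of_mem_orientedRays hfin haz
    have f3 := ne_top_of_mem_orientedRays hfin hzq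
    have e1 := (hX.orientedRays_trans hΓ hfin hxz hzq).2
    have e2 := (hX.orientedRays_trans hΓ hfin haz hzq).2
    rw [hX.symm] at f1 f2 f3
    obtain ⟨f4, e3⟩ := hX.aligned_of_prolongation f3 hne.symm f2 f1
      (by rw [hX.toReal_comm q a, hX.toReal_comm q z, hX.toReal_comm z a]; linarith)
      (by rw [hX.toReal_comm q x, hX.toReal_comm q z, hX.toReal_comm z x]; linarith)
      (by rwa [hX.toReal_comm z a, hX.toReal_comm z x])
    rw [hX.toReal_comm z a, hX.toReal_comm z x, hX.toReal_comm a x] at e3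
    rw [hX.symm] at f4 f2
    have := (hX.mem_orientedRays_of_between hfin hxz f4 f2 (by linarith)).1
    convert moves_of_mem hfin this using 1
    linarith
  rcases le_total (dL a z).toReal (dL x z).toReal with h | h
  · exact hle x a hxz haz h
  · rw [← moves_neg, neg_sub]
    exact hle a x haz hxz h

theorem moves_add_of_nonpos_of_nonneg (hX : IsGeodesicStructure X dL)
    (hΓ : IsCyclicallyMonotone dL Γ)
    (hfin : ∀ p ∈ Γ, dL p.1 p.2 ≠ ∞) {x z a p : X} (hpz : (p, z) ∈ orientedRays dL Γ)
    (hne : z ≠ p) (hzx : (z, x) ∈ orientedRays dL Γ) (hza : (z, a) ∈ orientedRays dL Γ) :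
    Moves dL Γ ((dL z a).toReal - (dL z x).toReal) x a := by
  have hle : ∀ x a : X, (z, x) ∈ orientedRays dL Γ → (z, a) ∈ orientedRays dL Γ →
      (dL z x).toReal ≤ (dL z a).toReal →
      Moves dL Γ ((dL z a).toReal - (dL z x).toReal) x a := by
    intro x a hzx hza hle
    have f1 := ne_top_of_mem_orientedRays hfin hzx
    have f2 := ne_top_of_mem_orientedRays hfin hza
    have f3 := ne_top_of_mem_orientedRays hfin hpz
    obtain ⟨f4, e3⟩ := hX.aligned_of_prolongation f3 hne.symm f1 f2
      (hX.orientedRays_trans hΓ hfin hpz hzx).2 (hX.orientedRays_trans hΓ hfin hpz hza).2 hle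
    have := (hX.mem_orientedRays_of_between hfin hza f1 f4 e3).2
    convert moves_of_mem hfin this using 1
    linarith
  rcases le_total (dL z x).toReal (dL z a).toReal with h | h
  · exact hle x a hzx hza h
  · rw [← moves_neg, neg_sub]
    exact hle a x hza hzx h

/-- Composition of movements through a point of the transport set. -/
theorem moves_add (hX : IsGeodesicStructure X dL) (hΓ : IsCyclicallyMonotone dL Γ)
    (hfin : ∀ p ∈ Γ, dL p.1 p.2 ≠ ∞) {s r : ℝ}
    {x z a : X} (hz : z ∈ transportSet dL Γ) (h : Moves dL Γ s x z) (h' : Moves dL Γ r z a) :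
    Moves dL Γ (s + r) x a := by
  obtain ⟨⟨p, hp, hzp⟩, q, hq, hzq⟩ := hz
  -- Equal signs use transitivity of rays. Opposite signs use non-branching at `z`, with `q` after
  -- it or `p` before it as the common piece.
  rcases le_total 0 s with hs | hs <;> rcases le_total 0 r with hr | hr
  · obtain ⟨g, rfl⟩ := hX.mem_of_moves hfin hs h
    obtain ⟨g', rfl⟩ := hX.mem_of_moves hfin hr h'
    obtain ⟨h2, e⟩ := hX.orientedRays_trans hΓ hfin g g'
    rw [← e]
    exact moves_of_mem hfin h2
  · obtain ⟨g, rfl⟩ := hX.mem_of_moves hfin hs h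
    obtain ⟨h', e⟩ := hX.mem_of_moves hfin (neg_nonneg.2 hr) (moves_neg.2 h')
    convert hX.moves_add_of_nonneg_of_nonpos hΓ hfin hq hzq g h' using 1
    linarith
  · obtain ⟨h, e⟩ := hX.mem_of_moves hfin (neg_nonneg.2 hs) (moves_neg.2 h)
    obtain ⟨g', rfl⟩ := hX.mem_of_moves hfin hr h'
    convert hX.moves_add_of_nonpos_of_nonneg hΓ hfin hp hzp h g' using 1
    linarith
  · obtain ⟨h, e⟩ := hX.mem_of_moves hfin (neg_nonneg.2 hs) (moves_neg.2 h)
    obtain ⟨h', e'⟩ := hX.mem_of_moves hfin (neg_nonneg.2 hr) (moves_neg.2 h')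
    obtain ⟨h2, e2⟩ := hX.orientedRays_trans hΓ hfin h' h
    rw [← moves_neg]
    convert moves_of_mem hfin h2 using 1
    linarith

theorem moves_unique (hX : IsGeodesicStructure X dL) (hΓ : IsCyclicallyMonotone dL Γ)
    (hfin : ∀ p ∈ Γ, dL p.1 p.2 ≠ ∞) {s : ℝ}
    {x z z' : X} (hx : x ∈ transportSet dL Γ) (h : Moves dL Γ s x z) (h' : Moves dL Γ s x z') :
    z = z' := by
  have := hX.moves_add hΓ hfin hx (moves_neg.2 h) h'
  rw [neg_add_cancel] at this
  exact hX.eq_of_moves_zero hfin this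

/-- A nontrivial oriented ray contains a point of the transport set strictly between its ends. -/
theorem exists_mem_transportSet_between (hX : IsGeodesicStructure X dL)
    (hfin : ∀ p ∈ Γ, dL p.1 p.2 ≠ ∞) {x y : X}
    (h : (x, y) ∈ orientedRays dL Γ) (hne : x ≠ y) :
    ∃ m ∈ transportSet dL Γ, (x, m) ∈ orientedRays dL Γ ∧ (m, y) ∈ orientedRays dL Γ := by
  have hf := ne_top_of_mem_orientedRays hfin h
  have hpos := hX.toReal_pos hf hne
  obtain ⟨γ, hγ, h0, h1⟩ := hX.geodesic x y hf
  have e1 := hγ.ne_top_and_toReal (s := 0) (t := (dL x y).toReal / 2) ⟨le_rfl, hpos.le⟩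
    ⟨by linarith, by linarith⟩ (by linarith)
  have e2 := hγ.ne_top_and_toReal (s := (dL x y).toReal / 2) (t := (dL x y).toReal)
    ⟨by linarith, by linarith⟩ ⟨hpos.le, le_rfl⟩ (by linarith)
  rw [h0] at e1
  rw [h1] at e2
  obtain ⟨hm1, hm2⟩ := hX.mem_orientedRays_of_between hfin h e1.1 e2.1 (by linarith [e1.2, e2.2])
  refine ⟨_, ⟨⟨x, hm1, ?_⟩, y, hm2, ?_⟩, hm1, hm2⟩
  · intro heq
    rw [heq, hX.self, ENNReal.toReal_zero] at e1
    linarith [e1.2]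
  · intro heq
    rw [heq, hX.self, ENNReal.toReal_zero] at e2
    linarith [e2.2]

theorem moves_zero_self (hX : IsGeodesicStructure X dL) (hfin : ∀ p ∈ Γ, dL p.1 p.2 ≠ ∞) {x : X}
    (hx : x ∈ transportSetE dL Γ) : Moves dL Γ 0 x x := by
  have h0 : (x, x) ∈ orientedRays dL Γ := by
    have f0 : dL x x ≠ ∞ := by simp [hX.self]
    rcases hx with ⟨y, h, -⟩ | ⟨y, h, -⟩
    · exact (hX.mem_orientedRays_of_between hfin h (ne_top_of_mem_orientedRays hfin h) f0
        (by simp [hX.self])).2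
    · exact (hX.mem_orientedRays_of_between hfin h f0 (ne_top_of_mem_orientedRays hfin h)
        (by simp [hX.self])).1
  have := moves_of_mem hfin h0
  rwa [hX.self, ENNReal.toReal_zero] at this

/-- Displacements compose only through points of `𝒯`, while `z` and `x` may be end points of a ray.
An intermediate point `m` of the ray serves as a base point for both. -/
theorem exists_mem_transportSet_moves (hX : IsGeodesicStructure X dL)
    (hfin : ∀ p ∈ Γ, dL p.1 p.2 ≠ ∞)
    (hΓ : IsCyclicallyMonotone dL Γ) {t : ℝ} {z x : X}
    (hz : z ∈ transportSetE dL Γ) (h : Moves dL Γ t z x) :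
    ∃ m ∈ transportSet dL Γ, ∃ σ, Moves dL Γ σ m z ∧ Moves dL Γ (σ + t) m x := by
  have pos : ∀ {t : ℝ} {z x : X}, 0 < t → Moves dL Γ t z x →
      ∃ m ∈ transportSet dL Γ, ∃ σ, Moves dL Γ σ m z ∧ Moves dL Γ (σ + t) m x := by
    intro t z x ht h
    obtain ⟨g, rfl⟩ := hX.mem_of_moves hfin ht.le h
    have hne : z ≠ x := by
      rintro rfl
      simp [hX.self] at ht
    obtain ⟨m, hm, hzm, hmx⟩ := hX.exists_mem_transportSet_between hfin g hne
    refine ⟨m, hm, -(dL z m).toReal, moves_neg.2 (moves_of_mem hfin hzm), ?_⟩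
    rw [(hX.orientedRays_trans hΓ hfin hzm hmx).2, neg_add_cancel_left]
    exact moves_of_mem hfin hmx
  rcases lt_trichotomy t 0 with ht | rfl | ht
  · obtain ⟨m, hm, σ, h1, h2⟩ := pos (neg_pos.2 ht) (moves_neg.2 h)
    refine ⟨m, hm, σ + -t, h2, ?_⟩
    rwa [neg_add_cancel_right]
  · obtain rfl := hX.eq_of_moves_zero hfin h
    rcases hz with ⟨y, hy, hne⟩ | ⟨y, hy, hne⟩
    · obtain ⟨m, hm, hzm, hmx⟩ := hX.exists_mem_transportSet_between hfin hy hne.symm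
      exact ⟨m, hm, _, moves_of_mem hfin hmx, by simpa using moves_of_mem hfin hmx⟩
    · obtain ⟨m, hm, hzm, hmx⟩ := hX.exists_mem_transportSet_between hfin hy hne
      exact ⟨m, hm, _, moves_neg.2 (moves_of_mem hfin hzm),
        by simpa using moves_neg.2 (moves_of_mem hfin hzm)⟩
  · exact pos ht h

theorem mem_rayMap_iff (hX : IsGeodesicStructure X dL) (hfin : ∀ p ∈ Γ, dL p.1 p.2 ≠ ∞) {S : Set X}
    {y x : X} {τ : ℝ} :
    ((y, τ), x) ∈ rayMap dL Γ S ↔ y ∈ S ∧ Moves dL Γ τ y x := by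
  constructor
  · rintro (⟨hy, h0, h, hd⟩ | ⟨hy, h0, h, hd⟩)
    · exact ⟨hy, Or.inl ⟨h0, h, (hX.symm _ _).trans hd⟩⟩
    · exact ⟨hy, Or.inr ⟨h0.le, h, hd⟩⟩
  · rintro ⟨hy, hm⟩
    rcases le_or_gt 0 τ with h0 | h0
    · obtain ⟨h, e⟩ := hX.mem_of_moves hfin h0 hm
      refine Or.inl ⟨hy, h0, h, ?_⟩
      rw [← e, ENNReal.ofReal_toReal, hX.symm]
      exact ne_top_of_mem_orientedRays hfin h
    · obtain ⟨h, e⟩ := hX.mem_of_moves hfin (neg_pos.2 h0).le (moves_neg.2 hm)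
      refine Or.inr ⟨hy, h0, h, ?_⟩
      simp only
      rw [← e, ENNReal.ofReal_toReal]
      exact ne_top_of_mem_orientedRays hfin h

/-! ### Evolutions and convex sets in terms of displacements. -/

/-- The evolution of a set does not depend on the cross-section. -/
theorem evolution_eq (hX : IsGeodesicStructure X dL) (hΓ : IsCyclicallyMonotone dL Γ)
    (hfin : ∀ p ∈ Γ, dL p.1 p.2 ≠ ∞)
    {S : Set X} (hS : IsCrossSection dL Γ S) {A : Set X} (hA : A ⊆ transportSetE dL Γ) (t : ℝ) :
    evolution dL Γ S A t = {x | ∃ z ∈ A, Moves dL Γ t z x} := by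
  ext x
  constructor
  · rintro ⟨y, τ, ⟨z, hz, hyz⟩, hyx⟩
    rw [hX.mem_rayMap_iff hfin] at hyz hyx
    refine ⟨z, hz, ?_⟩
    have := hX.moves_add hΓ hfin (hS.1 hyz.1) (moves_neg.2 hyz.2) hyx.2
    rwa [neg_add_cancel_left] at this
  · rintro ⟨z, hz, h⟩
    obtain ⟨m, hm, σ, h1, h2⟩ := hX.exists_mem_transportSet_moves hfin hΓ (hA hz) h
    obtain ⟨y, ⟨hy, hmy⟩, -⟩ := hS.2 m hm
    obtain ⟨ρ, hρ⟩ : ∃ ρ, Moves dL Γ ρ y m := by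
      rcases hmy with h | h
      · exact ⟨_, moves_neg.2 (moves_of_mem hfin h)⟩
      · exact ⟨_, moves_of_mem hfin h⟩
    refine ⟨y, ρ + σ, ⟨z, hz, (hX.mem_rayMap_iff hfin).2 ⟨hy, hX.moves_add hΓ hfin hm hρ h1⟩⟩,
      (hX.mem_rayMap_iff hfin).2 ⟨hy, ?_⟩⟩
    rw [add_assoc]
    exact hX.moves_add hΓ hfin hm hρ h2

theorem evolution_zero (hX : IsGeodesicStructure X dL) (hΓ : IsCyclicallyMonotone dL Γ)
    (hfin : ∀ p ∈ Γ, dL p.1 p.2 ≠ ∞)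
    {S : Set X} (hS : IsCrossSection dL Γ S) {A : Set X} (hA : A ⊆ transportSetE dL Γ) :
    evolution dL Γ S A 0 = A := by
  rw [hX.evolution_eq hΓ hfin hS hA]
  ext x
  constructor
  · rintro ⟨z, hz, h⟩
    rwa [← hX.eq_of_moves_zero hfin h]
  · exact fun hx => ⟨x, hx, hX.moves_zero_self hfin (hA hx)⟩

theorem evolution_subset (hX : IsGeodesicStructure X dL) (hΓ : IsCyclicallyMonotone dL Γ)
    (hfin : ∀ p ∈ Γ, dL p.1 p.2 ≠ ∞)
    {S : Set X} (hS : IsCrossSection dL Γ S) {A : Set X} (hA : A ⊆ transportSetE dL Γ) (t : ℝ) :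
    evolution dL Γ S A t ⊆ transportSetE dL Γ := by
  rcases eq_or_ne t 0 with rfl | ht
  · rwa [hX.evolution_zero hΓ hfin hS hA]
  · rw [hX.evolution_eq hΓ hfin hS hA]
    rintro x ⟨z, -, h⟩
    exact (mem_transportSetE_of_moves ht h hX.self).2

/-- The parameters at which the ray through `x` meets a geodesically convex set form an
interval. -/
theorem ordConnected_moves (hX : IsGeodesicStructure X dL) (hΓ : IsCyclicallyMonotone dL Γ)
    (hfin : ∀ p ∈ Γ, dL p.1 p.2 ≠ ∞)
    {A : Set X} (hA : IsGeodesicallyConvex dL A) {x : X} (hx : x ∈ transportSet dL Γ) :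
    {s : ℝ | ∃ a ∈ A, Moves dL Γ s x a}.OrdConnected := by
  refine ⟨?_⟩
  rintro s ⟨a, ha, hs⟩ s' ⟨a', ha', hs'⟩ r ⟨hr, hr'⟩
  rcases hr.eq_or_lt with rfl | hr
  · exact ⟨a, ha, hs⟩
  rcases hr'.eq_or_lt with rfl | hr'
  · exact ⟨a', ha', hs'⟩
  have haa' := hX.moves_add hΓ hfin hx (moves_neg.2 hs) hs'
  obtain ⟨hG, he⟩ := hX.mem_of_moves hfin (by linarith) haa'
  have hf := ne_top_of_mem_orientedRays hfin hG
  -- If `a` and `a'` lie on the same side of `x`, any geodesic between them can be used, since it is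
  -- attached to `x` through the nearer of the two.
  rcases le_total 0 s with h0 | h0
  · obtain ⟨γ, hγ, e0, e1⟩ := hX.geodesic a a' hf
    rw [he] at hγ e1
    have hb := hA γ 0 _ (by linarith) hγ (e0 ▸ ha) (e1 ▸ ha') (r - s)
      ⟨by linarith, by linarith⟩
    have d1 := hγ.ne_top_and_toReal (s := 0) (t := r - s) ⟨by linarith, by linarith⟩
      ⟨by linarith, by linarith⟩ (by linarith)
    have d2 := hγ.ne_top_and_toReal (s := r - s) (t := -s + s') ⟨by linarith, by linarith⟩
      ⟨by linarith, by linarith⟩ (by linarith)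
    rw [e0] at d1
    rw [e1] at d2
    have hab := (hX.mem_orientedRays_of_between hfin hG d1.1 d2.1
      (by linarith [d1.2, d2.2])).1
    obtain ⟨hxa, hxs⟩ := hX.mem_of_moves hfin h0 hs
    obtain ⟨hxb, e⟩ := hX.orientedRays_trans hΓ hfin hxa hab
    refine ⟨_, hb, ?_⟩
    convert moves_of_mem hfin hxb using 1
    linarith [d1.2]
  rcases le_total s' 0 with h0' | h0'
  · obtain ⟨γ, hγ, e0, e1⟩ := hX.geodesic a a' hf
    rw [he] at hγ e1
    have hb := hA γ 0 _ (by linarith) hγ (e0 ▸ ha) (e1 ▸ ha') (r - s)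
      ⟨by linarith, by linarith⟩
    have d1 := hγ.ne_top_and_toReal (s := 0) (t := r - s) ⟨by linarith, by linarith⟩
      ⟨by linarith, by linarith⟩ (by linarith)
    have d2 := hγ.ne_top_and_toReal (s := r - s) (t := -s + s') ⟨by linarith, by linarith⟩
      ⟨by linarith, by linarith⟩ (by linarith)
    rw [e0] at d1
    rw [e1] at d2
    have hba' := (hX.mem_orientedRays_of_between hfin hG d1.1 d2.1
      (by linarith [d1.2, d2.2])).2
    obtain ⟨hax, hxs⟩ := hX.mem_of_moves hfin (neg_nonneg.2 h0') (moves_neg.2 hs')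
    obtain ⟨hbx, e⟩ := hX.orientedRays_trans hΓ hfin hba' hax
    refine ⟨_, hb, moves_neg.1 ?_⟩
    convert moves_of_mem hfin hbx using 1
    linarith [d2.2]
  -- Here `x` lies between `a` and `a'`. Geodesics between these points are not known to be unique,
  -- so one through `x` is built by concatenation.
  · obtain ⟨hax, h1⟩ := hX.mem_of_moves hfin (neg_nonneg.2 h0) (moves_neg.2 hs)
    obtain ⟨hxa', h2⟩ := hX.mem_of_moves hfin h0' hs'
    have f1 := ne_top_of_mem_orientedRays hfin hax
    have f2 := ne_top_of_mem_orientedRays hfin hxa'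
    obtain ⟨γ₀, hγ₀, g0, g1⟩ := hX.geodesic a x f1
    obtain ⟨γ, hγ, e, e1⟩ := hX.exists_geodesic_through f1 f2 (by linarith) hγ₀ g0 g1
    have e0 : γ 0 = a := (e ⟨le_rfl, ENNReal.toReal_nonneg⟩).trans g0
    have ex : γ (dL a x).toReal = x := (e ⟨ENNReal.toReal_nonneg, le_rfl⟩).trans g1
    rw [h1, h2] at hγ e1
    rw [h1] at ex
    have hb := hA γ 0 _ (by linarith) hγ (e0 ▸ ha) (e1 ▸ ha') (r - s)
      ⟨by linarith, by linarith⟩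
    refine ⟨_, hb, ?_⟩
    rcases le_total r 0 with hr0 | hr0
    · have d1 := hγ.ne_top_and_toReal (s := 0) (t := r - s) ⟨by linarith, by linarith⟩
        ⟨by linarith, by linarith⟩ (by linarith)
      have d2 := hγ.ne_top_and_toReal (s := r - s) (t := -s) ⟨by linarith, by linarith⟩
        ⟨by linarith, by linarith⟩ (by linarith)
      rw [e0] at d1
      rw [ex] at d2
      have := (hX.mem_orientedRays_of_between hfin hax d1.1 d2.1
        (by linarith [d1.2, d2.2])).2
      refine moves_neg.1 ?_
      convert moves_of_mem hfin this using 1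
      linarith [d2.2]
    · have d1 := hγ.ne_top_and_toReal (s := -s) (t := r - s) ⟨by linarith, by linarith⟩
        ⟨by linarith, by linarith⟩ (by linarith)
      have d2 := hγ.ne_top_and_toReal (s := r - s) (t := -s + s') ⟨by linarith, by linarith⟩
        ⟨by linarith, by linarith⟩ (by linarith)
      rw [ex] at d1
      rw [e1] at d2
      have := (hX.mem_orientedRays_of_between hfin hxa' d1.1 d2.1
        (by linarith [d1.2, d2.2])).1
      convert moves_of_mem hfin this using 1
      linarith [d1.2]

end IsGeodesicStructure

end Geometry

/-! ### Analyticity of the sets of rays. -/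

section Analytic

theorem analyticSet_inter {α : Type*} [TopologicalSpace α] [T2Space α] {s t : Set α}
    (hs : AnalyticSet s) (ht : AnalyticSet t) : AnalyticSet (s ∩ t) := by
  rw [inter_eq_iInter]
  exact AnalyticSet.iInter fun b => by cases b <;> assumption

theorem analyticSet_union {α : Type*} [TopologicalSpace α] {s t : Set α}
    (hs : AnalyticSet s) (ht : AnalyticSet t) : AnalyticSet (s ∪ t) := by
  rw [union_eq_iUnion]
  exact AnalyticSet.iUnion fun b => by cases b <;> assumption

theorem analyticSet_exists {α β : Type*} [TopologicalSpace α] [TopologicalSpace β]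
    {s : Set (α × β)} (hs : AnalyticSet s) : AnalyticSet {x | ∃ y, (x, y) ∈ s} := by
  convert hs.image_of_continuous continuous_fst using 1
  ext x
  simp

variable {X : Type*} [MetricSpace X] [PolishSpace X] [MeasurableSpace X] [BorelSpace X]
  {dL : X → X → ℝ≥0∞} {Γ : Set (X × X)}

theorem analyticSet_cycleClosure (hd : Measurable fun p : X × X => dL p.1 p.2)
    (hΓ : MeasurableSet Γ) : AnalyticSet (cycleClosure dL Γ) := by
  have h : cycleClosure dL Γ = ⋃ n : ℕ,
      (fun p : (Fin (n + 1) → X) × (Fin (n + 1) → X) => (p.1 0, p.2 (Fin.last n))) ''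
        ({p | ∀ i, (p.1 i, p.2 i) ∈ Γ} ∩
          {p | ∑ i, dL (p.1 (i + 1)) (p.2 i) = ∑ i, dL (p.1 i) (p.2 i)}) := by
    ext ⟨x, y⟩
    simp only [mem_iUnion, mem_image, Prod.mk.injEq, Prod.exists]
    constructor
    · rintro ⟨n, w, z, h, hw, hz, he⟩
      exact ⟨n, w, z, ⟨h, he⟩, hw, hz⟩
    · rintro ⟨n, w, z, ⟨h, he⟩, hw, hz⟩
      exact ⟨n, w, z, h, hw, hz, he⟩
  rw [h]
  refine AnalyticSet.iUnion fun n => AnalyticSet.image_of_continuous (MeasurableSet.analyticSet ?_)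
    (by fun_prop)
  have hm : ∀ i j : Fin (n + 1),
      Measurable fun p : (Fin (n + 1) → X) × (Fin (n + 1) → X) => (p.1 i, p.2 j) := by
    intro i j
    fun_prop
  refine MeasurableSet.inter ?_ ?_
  · rw [ofPred_forall]
    exact MeasurableSet.iInter fun i => hm i i hΓ
  · exact measurableSet_eq_fun (Finset.measurable_fun_sum _ fun i _ => hd.comp (hm (i + 1) i))
      (Finset.measurable_fun_sum _ fun i _ => hd.comp (hm i i))

theorem analyticSet_orientedRays (hd : Measurable fun p : X × X => dL p.1 p.2)
    (hΓ : MeasurableSet Γ) : AnalyticSet (orientedRays dL Γ) := by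
  have hs : AnalyticSet {p : (X × X) × (X × X) | p.2 ∈ cycleClosure dL Γ ∧
      dL p.2.1 p.1.1 + dL p.1.1 p.1.2 + dL p.1.2 p.2.2 = dL p.2.1 p.2.2} := by
    refine analyticSet_inter ((analyticSet_cycleClosure hd hΓ).preimage continuous_snd)
      (MeasurableSet.analyticSet ?_)
    refine measurableSet_eq_fun ?_ ?_
    · exact ((hd.comp (f := fun p : (X × X) × (X × X) => (p.2.1, p.1.1)) (by fun_prop)).add
        (hd.comp (f := fun p : (X × X) × (X × X) => (p.1.1, p.1.2)) (by fun_prop))).add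
        (hd.comp (f := fun p : (X × X) × (X × X) => (p.1.2, p.2.2)) (by fun_prop))
    · exact hd.comp (f := fun p : (X × X) × (X × X) => (p.2.1, p.2.2)) (by fun_prop)
  exact analyticSet_exists hs

theorem analyticSet_exists_pred (hd : Measurable fun p : X × X => dL p.1 p.2)
    (hΓ : MeasurableSet Γ) : AnalyticSet {x | ∃ y, (y, x) ∈ orientedRays dL Γ ∧ x ≠ y} :=
  analyticSet_exists (s := {p | (p.2, p.1) ∈ orientedRays dL Γ ∧ p.1 ≠ p.2})
    (analyticSet_inter ((analyticSet_orientedRays hd hΓ).preimage continuous_swap)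
      (measurableSet_eq_fun measurable_fst measurable_snd).compl.analyticSet)

theorem analyticSet_exists_succ (hd : Measurable fun p : X × X => dL p.1 p.2)
    (hΓ : MeasurableSet Γ) : AnalyticSet {x | ∃ y, (x, y) ∈ orientedRays dL Γ ∧ x ≠ y} :=
  analyticSet_exists (s := {p | p ∈ orientedRays dL Γ ∧ p.1 ≠ p.2})
    (analyticSet_inter (analyticSet_orientedRays hd hΓ)
      (measurableSet_eq_fun measurable_fst measurable_snd).compl.analyticSet)

theorem analyticSet_transportSet (hd : Measurable fun p : X × X => dL p.1 p.2)
    (hΓ : MeasurableSet Γ) : AnalyticSet (transportSet dL Γ) :=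
  analyticSet_inter (analyticSet_exists_pred hd hΓ) (analyticSet_exists_succ hd hΓ)

theorem analyticSet_transportSetE (hd : Measurable fun p : X × X => dL p.1 p.2)
    (hΓ : MeasurableSet Γ) : AnalyticSet (transportSetE dL Γ) :=
  analyticSet_union (analyticSet_exists_pred hd hΓ) (analyticSet_exists_succ hd hΓ)

/-- Pairs `(x, s)` such that moving from `x` by the signed length `s` leads to `B`. -/
def reach {X : Type*} (dL : X → X → ℝ≥0∞) (Γ : Set (X × X)) (B : Set X) : Set (X × ℝ) :=
  {p | ∃ a ∈ B, Moves dL Γ p.2 p.1 a}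

theorem analyticSet_reach (hd : Measurable fun p : X × X => dL p.1 p.2)
    (hΓ : MeasurableSet Γ) {B : Set X} (hB : MeasurableSet B) : AnalyticSet (reach dL Γ B) := by
  have hG := analyticSet_orientedRays hd hΓ
  have hs : AnalyticSet {p : (X × ℝ) × X | p.2 ∈ B ∧ Moves dL Γ p.1.2 p.1.1 p.2} := by
    refine analyticSet_inter (measurable_snd hB).analyticSet (analyticSet_union ?_ ?_)
    · refine analyticSet_inter (measurableSet_le measurable_const measurable_fst.snd).analyticSet
        (analyticSet_inter (hG.preimage (f := fun p : (X × ℝ) × X => (p.1.1, p.2)) (by fun_prop))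
          (measurableSet_eq_fun ?_ ?_).analyticSet)
      · exact hd.comp (f := fun p : (X × ℝ) × X => (p.1.1, p.2)) (by fun_prop)
      · fun_prop
    · refine analyticSet_inter (measurableSet_le measurable_fst.snd measurable_const).analyticSet
        (analyticSet_inter (hG.preimage (f := fun p : (X × ℝ) × X => (p.2, p.1.1)) (by fun_prop))
          (measurableSet_eq_fun ?_ ?_).analyticSet)
      · exact hd.comp (f := fun p : (X × ℝ) × X => (p.2, p.1.1)) (by fun_prop)
      · fun_prop
  exact analyticSet_exists hs

theorem IsMonotonePlan.measurableSet {μ ν : Measure X} {π : Measure (X × X)}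
    (hπ : IsMonotonePlan dL μ ν π Γ) : MeasurableSet Γ := by
  obtain ⟨K, -, hK, -, rfl⟩ := hπ.sigmaCompact
  exact MeasurableSet.iUnion fun n => (hK n).measurableSet

/-- The part over the transport set of the pairs `(x, u)` such that moving backwards from `x` by
the signed length `u` leads to `B`. -/
def backReach {X : Type*} (dL : X → X → ℝ≥0∞) (Γ : Set (X × X)) (B : Set X) : Set (X × ℝ) :=
  {p | p.1 ∈ transportSet dL Γ ∧ (p.1, -p.2) ∈ reach dL Γ B}

theorem analyticSet_backReach (hd : Measurable fun p : X × X => dL p.1 p.2)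
    (hΓ : MeasurableSet Γ) {B : Set X} (hB : MeasurableSet B) :
    AnalyticSet (backReach dL Γ B) :=
  analyticSet_inter ((analyticSet_transportSet hd hΓ).preimage continuous_fst)
    ((analyticSet_reach hd hΓ hB).preimage (f := fun p : X × ℝ => (p.1, -p.2)) (by fun_prop))

end Analytic

/-! ### Negligibility of the end points of rays. -/

section Measure

/-- The form in which the absolute continuity assumption enters all later arguments. -/
theorem measure_eq_zero_of_ae_evolution {X : Type*} [MeasurableSpace X] {dL : X → X → ℝ≥0∞}
    {Γ : Set (X × X)} {S : Set X} {μ : Measure X} (hμ : AbsContAssumption dL Γ S μ)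
    {B : Set X} (hB : MeasurableSet B) (hBT : B ⊆ transportSetE dL Γ)
    (h : ∀ᵐ t ∂(volume.restrict (Ioi (0 : ℝ))), μ (evolution dL Γ S B t) = 0) : μ B = 0 := by
  by_contra h0
  have := hμ B hB hBT (pos_iff_ne_zero.2 h0)
  rw [lintegral_congr_ae h, lintegral_zero] at this
  exact this.false

variable {X : Type*} [MetricSpace X] [PolishSpace X] [MeasurableSpace X] [BorelSpace X]
  {dL : X → X → ℝ≥0∞} {Γ : Set (X × X)} {S : Set X} {μ : Measure X}

namespace IsGeodesicStructure

theorem analyticSet_evolution (hX : IsGeodesicStructure X dL) (hΓ : IsCyclicallyMonotone dL Γ)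
    (hfin : ∀ p ∈ Γ, dL p.1 p.2 ≠ ∞) (hΓm : MeasurableSet Γ) (hS : IsCrossSection dL Γ S)
    {A : Set X} (hA : MeasurableSet A) (hAT : A ⊆ transportSetE dL Γ) (t : ℝ) :
    AnalyticSet (evolution dL Γ S A t) := by
  rw [hX.evolution_eq hΓ hfin hS hAT]
  have := (analyticSet_reach hX.borel hΓm hA).preimage (f := fun x : X => (x, -t)) (by fun_prop)
  convert this using 1
  ext x
  simp only [reach, mem_preimage, mem_ofPred_eq, moves_neg]

/-- Under the absolute continuity assumption the set of end points of rays is negligible. -/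
theorem measure_final_eq_zero (hX : IsGeodesicStructure X dL) (hΓ : IsCyclicallyMonotone dL Γ)
    (hfin : ∀ p ∈ Γ, dL p.1 p.2 ≠ ∞) (hΓm : MeasurableSet Γ) (hS : IsCrossSection dL Γ S)
    [IsFiniteMeasure μ] (hμ : AbsContAssumption dL Γ S μ) :
    μ (transportSetE dL Γ \ {x | ∃ y, (x, y) ∈ orientedRays dL Γ ∧ x ≠ y}) = 0 := by
  refine measure_eq_zero_of_forall_measurable_subset
    ((nullMeasurableSet_of_analyticSet μ (analyticSet_transportSetE hX.borel hΓm)).diff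
      (nullMeasurableSet_of_analyticSet μ (analyticSet_exists_succ hX.borel hΓm))) ?_
  intro B hB hBm
  have hBT : B ⊆ transportSetE dL Γ := hB.trans sdiff_subset
  refine measure_eq_zero_of_ae_evolution hμ hBm hBT ?_
  refine (ae_restrict_iff' measurableSet_Ioi).2 (ae_of_all _ fun t ht => ?_)
  rw [hX.evolution_eq hΓ hfin hS hBT]
  convert measure_empty (μ := μ)
  rw [eq_empty_iff_forall_notMem]
  rintro x ⟨z, hz, h⟩
  obtain ⟨hG, e⟩ := hX.mem_of_moves hfin (le_of_lt ht) h
  refine (hB hz).2 ⟨x, hG, ?_⟩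
  rintro rfl
  rw [hX.self, ENNReal.toReal_zero] at e
  exact ht.ne e

theorem exists_pred_of_moves (hX : IsGeodesicStructure X dL) (hfin : ∀ p ∈ Γ, dL p.1 p.2 ≠ ∞)
    {t : ℝ} (ht : 0 < t) {z x : X} (h : Moves dL Γ t z x) :
    ∃ y, (y, x) ∈ orientedRays dL Γ ∧ x ≠ y := by
  obtain ⟨hG, e⟩ := hX.mem_of_moves hfin ht.le h
  refine ⟨z, hG, ?_⟩
  rintro rfl
  rw [hX.self, ENNReal.toReal_zero] at e
  exact ht.ne e

/-- Under the absolute continuity assumption the set of initial points of rays is negligible. -/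
theorem measure_initial_eq_zero (hX : IsGeodesicStructure X dL) (hΓ : IsCyclicallyMonotone dL Γ)
    (hfin : ∀ p ∈ Γ, dL p.1 p.2 ≠ ∞) (hΓm : MeasurableSet Γ) (hS : IsCrossSection dL Γ S)
    [IsFiniteMeasure μ] (hμ : AbsContAssumption dL Γ S μ) :
    μ (transportSetE dL Γ \ {x | ∃ y, (y, x) ∈ orientedRays dL Γ ∧ x ≠ y}) = 0 := by
  refine measure_eq_zero_of_forall_measurable_subset
    ((nullMeasurableSet_of_analyticSet μ (analyticSet_transportSetE hX.borel hΓm)).diff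
      (nullMeasurableSet_of_analyticSet μ (analyticSet_exists_pred hX.borel hΓm))) ?_
  intro B hB hBm
  have hBT : B ⊆ transportSetE dL Γ := hB.trans sdiff_subset
  refine measure_eq_zero_of_ae_evolution hμ hBm hBT ?_
  -- A point of `𝒯` in the evolutions at two times `t < s` would yield a displacement of length `s -
  -- t > 0` ending at an initial point of `B`. The traces on `𝒯` are thus disjoint, and only
  -- countably many have positive measure.
  have hcount : {t : ℝ | 0 < μ (evolution dL Γ S B t ∩ transportSet dL Γ)}.Countable := by
    refine Measure.countable_meas_pos_of_disjoint_iUnion₀ (fun t => ?_) fun t s hts => ?_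
    · exact (nullMeasurableSet_of_analyticSet μ
        (hX.analyticSet_evolution hΓ hfin hΓm hS hBm hBT t)).inter
        (nullMeasurableSet_of_analyticSet μ (analyticSet_transportSet hX.borel hΓm))
    · refine Disjoint.aedisjoint (disjoint_left.2 ?_)
      have key : ∀ {t s : ℝ} {x : X}, t < s → x ∈ transportSet dL Γ →
          x ∈ evolution dL Γ S B t → x ∈ evolution dL Γ S B s → False := by
        intro t s x hlt hx ht hs
        rw [hX.evolution_eq hΓ hfin hS hBT] at ht hs
        obtain ⟨z, hz, h⟩ := ht
        obtain ⟨z', hz', h'⟩ := hs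
        exact (hB hz).2 (hX.exists_pred_of_moves hfin (by linarith)
          (hX.moves_add hΓ hfin hx h' (moves_neg.2 h)))
      rintro x ⟨ht, hx⟩ ⟨hs, -⟩
      rcases lt_or_gt_of_ne hts with hlt | hlt
      exacts [key hlt hx ht hs, key hlt hx hs ht]
  rw [ae_restrict_iff' measurableSet_Ioi]
  filter_upwards [hcount.ae_notMem volume] with t htc ht
  have h0 : μ (evolution dL Γ S B t ∩ transportSet dL Γ) = 0 := by simpa using htc
  -- For `t > 0` a point of the evolution has a predecessor, so outside `𝒯` it is a final point.
  refine measure_mono_null (t := (evolution dL Γ S B t ∩ transportSet dL Γ) ∪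
    (transportSetE dL Γ \ {x | ∃ y, (x, y) ∈ orientedRays dL Γ ∧ x ≠ y})) ?_
    (measure_union_null h0 (hX.measure_final_eq_zero hΓ hfin hΓm hS hμ))
  intro x hx
  by_cases hs : ∃ y, (x, y) ∈ orientedRays dL Γ ∧ x ≠ y
  · refine Or.inl ⟨hx, ?_, hs⟩
    rw [hX.evolution_eq hΓ hfin hS hBT] at hx
    obtain ⟨z, -, h⟩ := hx
    exact hX.exists_pred_of_moves hfin ht h
  · exact Or.inr ⟨hX.evolution_subset hΓ hfin hS hBT t hx, hs⟩

theorem measure_endpoints_eq_zero (hX : IsGeodesicStructure X dL)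
    (hΓ : IsCyclicallyMonotone dL Γ) (hfin : ∀ p ∈ Γ, dL p.1 p.2 ≠ ∞) (hΓm : MeasurableSet Γ)
    (hS : IsCrossSection dL Γ S) [IsFiniteMeasure μ] (hμ : AbsContAssumption dL Γ S μ) :
    μ (transportSetE dL Γ \ transportSet dL Γ) = 0 := by
  refine measure_mono_null ?_ (measure_union_null
    (hX.measure_initial_eq_zero hΓ hfin hΓm hS hμ) (hX.measure_final_eq_zero hΓ hfin hΓm hS hμ))
  rintro x ⟨hx, hx'⟩
  by_cases hp : ∃ y, (y, x) ∈ orientedRays dL Γ ∧ x ≠ y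
  · exact Or.inr ⟨hx, fun hs => hx' ⟨hp, hs⟩⟩
  · exact Or.inl ⟨hx, hp⟩

end IsGeodesicStructure

end Measure

/-! ### The lift of `μ` to pairs (point, length). -/

section

variable {X : Type*} [MetricSpace X] [PolishSpace X] [MeasurableSpace X] [BorelSpace X]
  {dL : X → X → ℝ≥0∞} {Γ : Set (X × X)} {S : Set X} {μ : Measure X}

open Classical in
/-- The point reached from `p.1` by moving backwards by the length `p.2` (and `p.1` if there is no
such point). -/
noncomputable def backPoint {X : Type*} (dL : X → X → ℝ≥0∞) (Γ : Set (X × X)) (p : X × ℝ) : X :=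
  if h : ∃ a, Moves dL Γ (-p.2) p.1 a then h.choose else p.1

theorem moves_backPoint {X : Type*} {dL : X → X → ℝ≥0∞} {Γ : Set (X × X)} {p : X × ℝ}
    (h : p ∈ backReach dL Γ univ) :
    Moves dL Γ (-p.2) p.1 (backPoint dL Γ p) := by
  have h' : ∃ a, Moves dL Γ (-p.2) p.1 a := by
    obtain ⟨-, a, -, ha⟩ := h
    exact ⟨a, ha⟩
  rw [backPoint, dif_pos h']
  exact h'.choose_spec

namespace IsGeodesicStructure

/-- Uniqueness of displacements from points of `𝒯` makes the choice in `backPoint` immaterial, so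
preimages of Borel sets are analytic on the domain that matters. -/
theorem backPoint_mem_iff (hX : IsGeodesicStructure X dL) (hΓ : IsCyclicallyMonotone dL Γ)
    (hfin : ∀ p ∈ Γ, dL p.1 p.2 ≠ ∞) {p : X × ℝ} (h : p ∈ backReach dL Γ univ) {B : Set X} :
    backPoint dL Γ p ∈ B ↔ p ∈ backReach dL Γ B := by
  have hm := moves_backPoint h
  constructor
  · exact fun hB => ⟨h.1, _, hB, hm⟩
  · rintro ⟨-, a, ha, hpa⟩
    rwa [hX.moves_unique hΓ hfin h.1 hm hpa]

theorem aemeasurable_backPoint (hX : IsGeodesicStructure X dL) (hΓ : IsCyclicallyMonotone dL Γ)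
    (hfin : ∀ p ∈ Γ, dL p.1 p.2 ≠ ∞) (hΓm : MeasurableSet Γ) (m : Measure (X × ℝ)) [SFinite m]
    (hm : ∀ᵐ p ∂m, p ∈ backReach dL Γ univ) : AEMeasurable (backPoint dL Γ) m := by
  refine NullMeasurable.aemeasurable fun B hB => ?_
  refine (nullMeasurableSet_of_analyticSet m (analyticSet_backReach hX.borel hΓm hB)).congr ?_
  filter_upwards [hm] with p hp
  exact propext (hX.backPoint_mem_iff hΓ hfin hp).symm

/-- A set is negligible if, for almost all lengths, so is the set of points of the transport set
from which it is reached by moving backwards. -/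
theorem measure_eq_zero_of_measure_backReach (hX : IsGeodesicStructure X dL)
    (hΓ : IsCyclicallyMonotone dL Γ) (hfin : ∀ p ∈ Γ, dL p.1 p.2 ≠ ∞) (hΓm : MeasurableSet Γ)
    (hS : IsCrossSection dL Γ S) [IsFiniteMeasure μ] (hμ : AbsContAssumption dL Γ S μ)
    {B : Set X} (hB : MeasurableSet B) (hBT : B ⊆ transportSetE dL Γ)
    (h : μ.prod (volume.restrict (Ioi 0)).toFinite
      (backReach dL Γ B ∩ Prod.snd ⁻¹' Ioi 0) = 0) : μ B = 0 := by
  refine measure_eq_zero_of_ae_evolution hμ hB hBT ?_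
  rw [← Measure.prod_swap] at h
  -- The slice at `t > 0` is the part of `B_t` in `𝒯`; the rest of `B_t` consists of end points.
  have h1 := Measure.measure_ae_null_of_prod_null
    (Measure.preimage_null_of_map_null measurable_swap.aemeasurable h)
  rw [ae_toFinite] at h1
  filter_upwards [h1, self_mem_ae_restrict measurableSet_Ioi] with t ht ht0
  refine measure_mono_null ?_ (measure_union_null ht
    (hX.measure_endpoints_eq_zero hΓ hfin hΓm hS hμ))
  intro x hx
  have hxT := hX.evolution_subset hΓ hfin hS hBT t hx
  by_cases hxt : x ∈ transportSet dL Γ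
  · rw [hX.evolution_eq hΓ hfin hS hBT] at hx
    obtain ⟨z, hz, h⟩ := hx
    exact Or.inl ⟨⟨hxt, z, hz, moves_neg.2 h⟩, ht0⟩
  · exact Or.inr ⟨hxT, hxt⟩

/-- Under the absolute continuity assumption the restriction of `μ` to the transport set lifts to
an absolutely continuous measure on the pairs (point, length). -/
theorem exists_lift (hX : IsGeodesicStructure X dL) (hΓ : IsCyclicallyMonotone dL Γ)
    (hfin : ∀ p ∈ Γ, dL p.1 p.2 ≠ ∞) (hΓm : MeasurableSet Γ) (hS : IsCrossSection dL Γ S)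
    [IsFiniteMeasure μ] (hμ : AbsContAssumption dL Γ S μ) :
    ∃ m : Measure (X × ℝ), IsFiniteMeasure m ∧ m ≪ μ.prod volume ∧
      (∀ᵐ p ∂m, p ∈ backReach dL Γ univ) ∧
      m.map (backPoint dL Γ) = μ.restrict (transportSet dL Γ) := by
  -- Only null sets of lengths matter, and a finite measure with the same null sets keeps `l` and
  -- its image `η` finite.
  set κ := (volume.restrict (Ioi (0 : ℝ))).toFinite with hκ
  set D : Set (X × ℝ) := backReach dL Γ univ ∩ Prod.snd ⁻¹' Ioi 0 with hD
  have hDm : NullMeasurableSet D (μ.prod κ) :=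
    (nullMeasurableSet_of_analyticSet _ (analyticSet_backReach hX.borel hΓm .univ)).inter
      (measurable_snd measurableSet_Ioi).nullMeasurableSet
  set l := (μ.prod κ).restrict D with hl
  have hlD : ∀ᵐ p ∂l, p ∈ D := ae_restrict_mem₀ hDm
  have hlb : ∀ᵐ p ∂l, p ∈ backReach dL Γ univ := hlD.mono fun p hp => hp.1
  have hψ := hX.aemeasurable_backPoint hΓ hfin hΓm l hlb
  have hTm : NullMeasurableSet (transportSet dL Γ) μ :=
    nullMeasurableSet_of_analyticSet _ (analyticSet_transportSet hX.borel hΓm)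
  set η := l.map (backPoint dL Γ) with hη
  have hac : μ.restrict (transportSet dL Γ) ≪ η := by
    refine Measure.AbsolutelyContinuous.mk fun s hs h0 => ?_
    rw [Measure.restrict_apply hs]
    refine measure_eq_zero_of_forall_measurable_subset (hs.nullMeasurableSet.inter hTm) ?_
    intro B hB hBm
    refine hX.measure_eq_zero_of_measure_backReach hΓ hfin hΓm hS hμ hBm
      (fun x hx => Or.inl (hB hx).2.1) ?_
    have h1 : l (backPoint dL Γ ⁻¹' B) = 0 := by
      rw [← Measure.map_apply_of_aemeasurable hψ hBm]
      exact measure_mono_null (hB.trans inter_subset_left) h0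
    rw [hl, Measure.restrict_apply₀' hDm] at h1
    refine measure_mono_null ?_ h1
    rintro p ⟨hp, hp0⟩
    have hpu : p ∈ backReach dL Γ univ := by
      obtain ⟨hT, a, -, ha⟩ := hp
      exact ⟨hT, a, mem_univ _, ha⟩
    exact ⟨(hX.backPoint_mem_iff hΓ hfin hpu).2 hp, hpu, hp0⟩
  set ψ := hψ.mk _
  have hψm : Measurable ψ := hψ.measurable_mk
  have hψe : backPoint dL Γ =ᵐ[l] ψ := hψ.ae_eq_mk
  have hηψ : η = l.map ψ := Measure.map_congr hψe
  set f := (μ.restrict (transportSet dL Γ)).rnDeriv η with hf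
  have hfm : Measurable f := Measure.measurable_rnDeriv _ _
  -- Pulling the density `f` back by `ψ` gives a measure whose image is `f · η`, that is, `μ`
  -- restricted to `𝒯`.
  have hml : l.withDensity (f ∘ ψ) ≪ l := withDensity_absolutelyContinuous _ _
  have hmap : (l.withDensity (f ∘ ψ)).map (backPoint dL Γ) = μ.restrict (transportSet dL Γ) := by
    rw [Measure.map_congr (hml.ae_le hψe)]
    ext s hs
    rw [Measure.map_apply hψm hs, withDensity_apply _ (hψm hs)]
    have := setLIntegral_map (μ := l) hs hfm hψm
    rw [← hηψ, hf, Measure.setLIntegral_rnDeriv hac] at this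
    exact this.symm
  refine ⟨l.withDensity (f ∘ ψ), ?_, ?_, hml.ae_le hlb, hmap⟩
  · have hm := hψ.mono_ac hml
    refine ⟨?_⟩
    have := Measure.map_apply_of_aemeasurable hm MeasurableSet.univ
    rw [hmap, preimage_univ] at this
    rw [← this]
    exact measure_lt_top _ _
  · refine hml.trans (Measure.absolutelyContinuous_restrict.trans ?_)
    exact Measure.AbsolutelyContinuous.rfl.prod
      ((toFinite_absolutelyContinuous _).trans Measure.absolutelyContinuous_restrict)

/-- Under the absolute continuity assumption evolutions are translations on the pairs
(point, length). -/
theorem exists_measure_evolution_eq (hX : IsGeodesicStructure X dL)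
    (hΓ : IsCyclicallyMonotone dL Γ) (hfin : ∀ p ∈ Γ, dL p.1 p.2 ≠ ∞) (hΓm : MeasurableSet Γ)
    (hS : IsCrossSection dL Γ S) [IsFiniteMeasure μ] (hμ : AbsContAssumption dL Γ S μ) :
    ∃ m : Measure (X × ℝ), IsFiniteMeasure m ∧ m ≪ μ.prod volume ∧
      ∀ A : Set X, MeasurableSet A → A ⊆ transportSetE dL Γ → ∀ t : ℝ,
        μ (evolution dL Γ S A t) = m {p | (p.1, p.2 + t) ∈ backReach dL Γ A} := by
  obtain ⟨m, hm, hac, hb, hmap⟩ := hX.exists_lift hΓ hfin hΓm hS hμ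
  refine ⟨m, hm, hac, fun A hA hAT t => ?_⟩
  have hψ := hX.aemeasurable_backPoint hΓ hfin hΓm m hb
  have hTm : NullMeasurableSet (transportSet dL Γ) μ :=
    nullMeasurableSet_of_analyticSet _ (analyticSet_transportSet hX.borel hΓm)
  have hEan := hX.analyticSet_evolution hΓ hfin hΓm hS hA hAT t
  have hET := hX.evolution_subset hΓ hfin hS hAT t
  have h1 : μ (evolution dL Γ S A t) = μ.restrict (transportSet dL Γ) (evolution dL Γ S A t) := by
    rw [Measure.restrict_apply₀' hTm]
    refine le_antisymm ?_ (measure_mono inter_subset_left)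
    rw [← add_zero (μ (_ ∩ _)), ← hX.measure_endpoints_eq_zero hΓ hfin hΓm hS hμ]
    refine (measure_mono fun x hx => ?_).trans (measure_union_le _ _)
    by_cases hxt : x ∈ transportSet dL Γ
    exacts [Or.inl ⟨hx, hxt⟩, Or.inr ⟨hET hx, hxt⟩]
  rw [h1, ← hmap, Measure.map_apply₀ hψ (nullMeasurableSet_of_analyticSet _ hEan)]
  refine measure_congr ?_
  -- One of the two inclusions composes displacements through `backPoint p`, which must therefore
  -- lie in `𝒯`; the other composes through `p.1`.
  have hT : ∀ᵐ p ∂m, backPoint dL Γ p ∈ transportSet dL Γ := by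
    refine ae_of_ae_map hψ ?_
    rw [hmap]
    exact ae_restrict_mem₀ hTm
  filter_upwards [hb, hT] with p hp hpT
  refine propext ?_
  have hmv := moves_backPoint hp
  show backPoint dL Γ p ∈ evolution dL Γ S A t ↔ (p.1, p.2 + t) ∈ backReach dL Γ A
  rw [hX.evolution_eq hΓ hfin hS hAT]
  constructor
  · rintro ⟨z, hz, h⟩
    refine ⟨hp.1, z, hz, ?_⟩
    simp only [neg_add]
    exact hX.moves_add hΓ hfin hpT hmv (moves_neg.2 h)
  · rintro ⟨-, z, hz, h⟩
    refine ⟨z, hz, ?_⟩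
    simp only [neg_add] at h
    have := hX.moves_add hΓ hfin hp.1 (moves_neg.2 hmv) h
    rw [neg_neg, add_neg_cancel_left] at this
    exact moves_neg.1 this

end IsGeodesicStructure

/-- Continuity of the evolution for nonnegative times implies the absolute continuity
assumption. -/
theorem absContAssumption_of_continuousOn {X : Type*} [MeasurableSpace X] {dL : X → X → ℝ≥0∞}
    {Γ : Set (X × X)} {S : Set X} {μ : Measure X} [IsFiniteMeasure μ]
    (h0 : ∀ A : Set X, A ⊆ transportSetE dL Γ → evolution dL Γ S A 0 = A)
    (h : ∀ A : Set X, MeasurableSet A → A ⊆ transportSetE dL Γ →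
      ContinuousOn (fun t : ℝ => μ.real (evolution dL Γ S A t)) (Ici 0)) :
    AbsContAssumption dL Γ S μ := by
  intro A hA hAT hpos
  have hreal : 0 < μ.real A := ENNReal.toReal_pos hpos.ne' (measure_ne_top _ _)
  have hc := h A hA hAT 0 self_mem_Ici
  -- Since `A_0 = A`, the measure of the evolution stays above half of `μ(A)` on some `[0, δ)`.
  have hev := hc.eventually (lt_mem_nhds (a := μ.real A / 2) (by
    simp only [h0 A hAT]
    linarith))
  obtain ⟨δ, hδ, hsub⟩ := mem_nhdsGE_iff_exists_Ico_subset.1 hev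
  have hδ' : (0 : ℝ) < δ := hδ
  calc (0 : ℝ≥0∞) < ENNReal.ofReal (μ.real A / 2) * volume (Ioo 0 δ) := by
        rw [Real.volume_Ioo]
        exact ENNReal.mul_pos (by simpa using hreal) (by simpa using hδ')
    _ = ∫⁻ _ in Ioo 0 δ, ENNReal.ofReal (μ.real A / 2) := (setLIntegral_const _ _).symm
    _ ≤ ∫⁻ t in Ioo 0 δ, μ (evolution dL Γ S A t) := by
        refine setLIntegral_mono' measurableSet_Ioo fun t ht => ?_
        rw [← ofReal_measureReal]
        exact ENNReal.ofReal_le_ofReal (hsub ⟨ht.1.le, ht.2⟩).le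
    _ ≤ ∫⁻ t in Ioi 0, μ (evolution dL Γ S A t) :=
        lintegral_mono_set fun t ht => ht.1

end

end GeodesicTransport

theorem propositionP {X : Type*} [MetricSpace X] [PolishSpace X] [MeasurableSpace X]
    [BorelSpace X] (dL : X → X → ℝ≥0∞) (hX : GeodesicTransport.IsGeodesicStructure X dL)
    (μ ν : Measure X) [IsProbabilityMeasure μ] [IsProbabilityMeasure ν]
    (π : Measure (X × X)) (Γ : Set (X × X))
    (hπ : GeodesicTransport.IsMonotonePlan dL μ ν π Γ)
    (S : Set X) (hS : GeodesicTransport.IsCrossSection dL Γ S) :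
    -- equivalence with continuity, for the evolution at all times
    (GeodesicTransport.AbsContAssumption dL Γ S μ ↔
      ∀ A : Set X, MeasurableSet A → A ⊆ GeodesicTransport.transportSetE dL Γ →
        Continuous fun t : ℝ => μ.real (GeodesicTransport.evolution dL Γ S A t)) ∧
    -- equivalence with continuity, for the evolution at nonnegative times only
    (GeodesicTransport.AbsContAssumption dL Γ S μ ↔
      ∀ A : Set X, MeasurableSet A → A ⊆ GeodesicTransport.transportSetE dL Γ →
        ContinuousOn (fun t : ℝ => μ.real (GeodesicTransport.evolution dL Γ S A t))
          (Ici 0)) ∧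
    -- absolute continuity for geodesically convex sets
    (GeodesicTransport.AbsContAssumption dL Γ S μ →
      ∀ A : Set X, MeasurableSet A → A ⊆ GeodesicTransport.transportSetE dL Γ →
        GeodesicTransport.IsGeodesicallyConvex dL A →
        GeodesicTransport.IsAbsolutelyContinuous
          fun t : ℝ => μ.real (GeodesicTransport.evolution dL Γ S A t)) := by
  have hΓ := hπ.monotone
  have hfin := hπ.finite_dist
  have hΓm := hπ.measurableSet
  have hnull : ∀ A : Set X, MeasurableSet A →
      NullMeasurableSet (GeodesicTransport.backReach dL Γ A) (μ.prod volume) := fun A hA =>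
    GeodesicTransport.nullMeasurableSet_of_analyticSet _
      (GeodesicTransport.analyticSet_backReach hX.borel hΓm hA)
  have hcont : GeodesicTransport.AbsContAssumption dL Γ S μ →
      ∀ A : Set X, MeasurableSet A → A ⊆ GeodesicTransport.transportSetE dL Γ →
        Continuous fun t : ℝ => μ.real (GeodesicTransport.evolution dL Γ S A t) := by
    intro hμ A hA hAT
    obtain ⟨m, hm, hac, hev⟩ := hX.exists_measure_evolution_eq hΓ hfin hΓm hS hμ
    simp only [Measure.real, hev A hA hAT]
    exact ENNReal.continuousOn_toReal.comp_continuous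
      (GeodesicTransport.continuous_measure_translate_snd hac (hnull A hA))
      fun t => measure_ne_top _ _
  have hback : (∀ A : Set X, MeasurableSet A → A ⊆ GeodesicTransport.transportSetE dL Γ →
      ContinuousOn (fun t : ℝ => μ.real (GeodesicTransport.evolution dL Γ S A t)) (Ici 0)) →
      GeodesicTransport.AbsContAssumption dL Γ S μ :=
    GeodesicTransport.absContAssumption_of_continuousOn fun A hAT =>
      hX.evolution_zero hΓ hfin hS hAT
  refine ⟨⟨hcont, fun h => hback fun A hA hAT => (h A hA hAT).continuousOn⟩,
    ⟨fun hμ A hA hAT => (hcont hμ A hA hAT).continuousOn, hback⟩, ?_⟩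
  intro hμ A hA hAT hconv
  obtain ⟨m, hm, hac, hev⟩ := hX.exists_measure_evolution_eq hΓ hfin hΓm hS hμ
  simp only [Measure.real, hev A hA hAT]
  refine GeodesicTransport.isAbsolutelyContinuous_measure_translate_snd hac (hnull A hA)
    fun x => ⟨?_⟩
  rintro u ⟨hx, hu⟩ v ⟨-, hv⟩ w ⟨huw, hwv⟩
  -- `backReach` records the opposite of the displacement, so the order is reversed; over points
  -- outside `𝒯` the slice is empty.
  exact ⟨hx, (hX.ordConnected_moves hΓ hfin hconv hx).out hv hu
    ⟨neg_le_neg hwv, neg_le_neg huw⟩⟩
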